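/- Consider two rigid bodies $X\in\{B,T\}$ (a UAV and a target) with $Q_X(t)\in SO(3)$, $p_X(t),v_X(t)\in\mathbb R^3$ and, for all $t\ge 0$, $\dot Q_X=Q_X\omega_X^\times$, $\dot p_X=v_X$, $\dot v_X=Q_Xa_X+g e_3$, where $\omega^\times$ is the matrix of $x\mapsto\omega\times x$, $\omega_X(t), a_X(t)\in\mathbb R^3$, $g\in\mathbb R$ is a constant and $e_3=(0,0,1)^\top$. Let $\xi=Q_B^\top(p_B-p_T)$, assume $\xi(t)\ne0$ for all $t\ge 0$, and put $y_\xi=\xi/|\xi|$, $y_\xi^{\mathcal I}=Q_By_\xi$ and $\pi_u=I_3-uu^\top$. Let $$A(t)=\begin{bmatrix}-\omega_B^\times& I_3\\ 0&-\omega_B^\times\end{bmatrix},\qquad C(t)=\begin{bmatrix}\pi_{y_\xi}&0_{3,3}\end{bmatrix}.$$ Assume that $\omega_B$ and $\omega_T$ are bounded and uniformly continuous on $[0,\infty)$, and that there exist $\delta,\mu>0$ such that for all $t\ge0$ $$\frac1\delta\int_t^{t+\delta}\pi_{y_\xi^{\mathcal I}(s)}\,ds\succeq\mu I_3 .$$ Then: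 (i) The pair $(A(t),C(t))$ is uniformly observable: there exist $\bar\delta,\bar\mu>0$ such that for all $t\ge0$ $$\frac1{\bar\delta}\int_t^{t+\bar\delta}\Phi(s,t)^\top C(s)^\top C(s)\Phi(s,t)\,ds\succeq\bar\mu I_6,$$ where $\Phi$ is the state transition matrix of $A$: $\partial_s\Phi(s,t)=A(s)\Phi(s,t)$, $\Phi(t,t)=I_6$. (ii) Let $S(t)\in\mathbb R^{6\times6}$ and $D(t)\in\mathbb R^{3\times3}$ be continuous, bounded, symmetric and uniformly positive definite on $[0,\infty)$ (i.e. $aI\preceq S(t)\preceq bI$ for some constants $0<a\le b$ and all $t\ge 0$, and similarly for $D$), and let $P_0\in\mathbb R^{6\times6}$ be symmetric positive definite. Then the Riccati equation $\dot P=AP+PA^\top-PC^\top DCP+S$, $P(0)=P_0$, has a unique solution on $[0,\infty)$, and with the gain $K=PC^\top D$ the equilibrium $x=0$ of the unforced error system $\dot x=(A(t)-K(t)C(t))x$ is globally exponentially stable: there are $c,\lambda>0$ such that for every $t_0\ge 0$ a solution on $[t_0,\infty)$ exists for each initial state $x(t_0)\in\mathbb R^6$, and every solution satisfies $|x(t)|\le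 c\,e^{-\lambda(t-t_0)}|x(t_0)|$ for all $t\ge t_0$. -/

import Mathlib

open Set Matrix

noncomputable section

/-- Euclidean norm of a real vector. -/
def euclNorm {n : Type*} [Fintype n] (x : n → ℝ) : ℝ := ‖WithLp.toLp 2 x‖

/-- The matrix `ω^×` of the cross product `x ↦ ω × x`. -/
def skew (ω : Fin 3 → ℝ) : Matrix (Fin 3) (Fin 3) ℝ :=
  !![0, -ω 2, ω 1; ω 2, 0, -ω 0; -ω 1, ω 0, 0]

/-- The matrix `π_u = I - u uᵀ`. -/
def proj (u : Fin 3 → ℝ) : Matrix (Fin 3) (Fin 3) ℝ := 1 - vecMulVec u u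

/-- The entrywise integral of a matrix-valued function over `[a, b]`. -/
def matIntegral {m n : Type*} (M : ℝ → Matrix m n ℝ) (a b : ℝ) : Matrix m n ℝ :=
  Matrix.of fun i j => ∫ s in a..b, M s i j

/-- The matrix-valued function `M` has, entrywise, derivative `M'` at `t` within `s`. -/
def MatHasDerivWithinAt {m n : Type*} (M : ℝ → Matrix m n ℝ) (M' : Matrix m n ℝ)
    (s : Set ℝ) (t : ℝ) : Prop :=
  ∀ i j, HasDerivWithinAt (fun τ => M τ i j) (M' i j) s t

/-- `M ⪰ c I` in the Loewner order (in particular, `M` is symmetric). -/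
def LoewnerGE {n : Type*} [DecidableEq n] (M : Matrix n n ℝ) (c : ℝ) : Prop :=
  (M - c • (1 : Matrix n n ℝ)).PosSemidef

/-! ### Linear time-varying systems on `[0, ∞)` -/

/-- `Φ s t` is the state transition matrix from time `t` to time `s` of `ẋ = A x`. -/
def IsTransitionMatrix {n : Type*} [Fintype n] [DecidableEq n]
    (A : ℝ → Matrix n n ℝ) (Φ : ℝ → ℝ → Matrix n n ℝ) : Prop :=
  ∀ t, 0 ≤ t → Φ t t = 1 ∧
    ∀ s, 0 ≤ s → MatHasDerivWithinAt (fun τ => Φ τ t) (A s * Φ s t) (Ici 0) s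

/-- The observability Gramian `W(t, t + δ)`. -/
def gramian {m n : Type*} [Fintype m] [Fintype n]
    (Φ : ℝ → ℝ → Matrix n n ℝ) (C : ℝ → Matrix m n ℝ) (t δ : ℝ) : Matrix n n ℝ :=
  (1 / δ) • matIntegral (fun s => (Φ s t)ᵀ * (C s)ᵀ * C s * Φ s t) t (t + δ)

/-- Uniform observability of the pair `(A, C)`. -/
def UniformlyObservable {m n : Type*} [Fintype m] [Fintype n] [DecidableEq n]
    (A : ℝ → Matrix n n ℝ) (C : ℝ → Matrix m n ℝ) : Prop :=
  ∃ Φ, IsTransitionMatrix A Φ ∧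
    ∃ δ μ : ℝ, 0 < δ ∧ 0 < μ ∧ ∀ t, 0 ≤ t → LoewnerGE (gramian Φ C t δ) μ

/-- `x` solves `ẋ = F(t) x` on `[t₀, ∞)`. -/
def IsLinearSolution {n : Type*} [Fintype n] (F : ℝ → Matrix n n ℝ) (t₀ : ℝ)
    (x : ℝ → n → ℝ) : Prop :=
  ∀ t, t₀ ≤ t → HasDerivWithinAt x (F t *ᵥ x t) (Ici t₀) t

/-- The origin of `ẋ = F(t) x` is (uniformly) globally exponentially stable: from every initial
time and state a solution exists, and all solutions obey one exponential bound. -/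
def GloballyExponentiallyStable {n : Type*} [Fintype n] (F : ℝ → Matrix n n ℝ) : Prop :=
  ∃ c l : ℝ, 0 < c ∧ 0 < l ∧ ∀ t₀, 0 ≤ t₀ → ∀ x₀ : n → ℝ,
    (∃ x, IsLinearSolution F t₀ x ∧ x t₀ = x₀) ∧
    ∀ x, IsLinearSolution F t₀ x → x t₀ = x₀ →
      ∀ t, t₀ ≤ t → euclNorm (x t) ≤ c * Real.exp (-l * (t - t₀)) * euclNorm x₀

/-- A continuous, bounded, uniformly positive definite symmetric matrix-valued function on
`[0, ∞)`. -/
def IsWeight {n : Type*} [DecidableEq n] (S : ℝ → Matrix n n ℝ) : Prop :=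
  ContinuousOn S (Ici 0) ∧
    ∃ a b : ℝ, 0 < a ∧ ∀ t, 0 ≤ t →
      LoewnerGE (S t) a ∧ (b • (1 : Matrix n n ℝ) - S t).PosSemidef

/-- `P` solves `Ṗ = A P + P Aᵀ - P Cᵀ D C P + S` on `[0, ∞)`. -/
def IsRiccatiSolution {m n : Type*} [Fintype m] [Fintype n]
    (A : ℝ → Matrix n n ℝ) (C : ℝ → Matrix m n ℝ) (D : ℝ → Matrix m m ℝ)
    (S : ℝ → Matrix n n ℝ) (P : ℝ → Matrix n n ℝ) : Prop :=
  ∀ t, 0 ≤ t → MatHasDerivWithinAt P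
    (A t * P t + P t * (A t)ᵀ - P t * (C t)ᵀ * D t * C t * P t + S t) (Ici 0) t

/-- The gain `K = P Cᵀ D`. -/
def riccatiGain {m n : Type*} [Fintype m] [Fintype n]
    (C : ℝ → Matrix m n ℝ) (D : ℝ → Matrix m m ℝ) (P : ℝ → Matrix n n ℝ) (t : ℝ) :
    Matrix n m ℝ :=
  P t * (C t)ᵀ * D t

/-! ### The two vehicles and the position/velocity error system -/

/-- A rigid motion on `[0, ∞)` under gravity `g e₃`: attitude `Q`, inertial position `p` and
velocity `v`, body-frame angular velocity `ω` and specific acceleration `a`. -/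
structure RigidMotion (g : ℝ) where
  Q : ℝ → Matrix (Fin 3) (Fin 3) ℝ
  p : ℝ → Fin 3 → ℝ
  v : ℝ → Fin 3 → ℝ
  ω : ℝ → Fin 3 → ℝ
  a : ℝ → Fin 3 → ℝ
  Q_mem : ∀ t, 0 ≤ t → Q t ∈ Matrix.specialOrthogonalGroup (Fin 3) ℝ
  Q_deriv : ∀ t, 0 ≤ t → MatHasDerivWithinAt Q (Q t * skew (ω t)) (Ici 0) t
  p_deriv : ∀ t, 0 ≤ t → HasDerivWithinAt p (v t) (Ici 0) t
  v_deriv : ∀ t, 0 ≤ t → HasDerivWithinAt v (Q t *ᵥ a t + g • ![0, 0, 1]) (Ici 0) t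

/-- The relative position `ξ = Q_Bᵀ (p_B - p_T)`. -/
def relPos {g : ℝ} (B T : RigidMotion g) (t : ℝ) : Fin 3 → ℝ :=
  (B.Q t)ᵀ *ᵥ (B.p t - T.p t)

/-- The bearing `y_ξ = ξ / |ξ|`. -/
def bearing {g : ℝ} (B T : RigidMotion g) (t : ℝ) : Fin 3 → ℝ :=
  (euclNorm (relPos B T t))⁻¹ • relPos B T t

/-- The bearing in the inertial frame, `Q_B y_ξ`. -/
def inertialBearing {g : ℝ} (B T : RigidMotion g) (t : ℝ) : Fin 3 → ℝ :=
  B.Q t *ᵥ bearing B T t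

/-- Persistence of excitation of a direction `y`. -/
def PersistentlyExciting (y : ℝ → Fin 3 → ℝ) : Prop :=
  ∃ δ μ : ℝ, 0 < δ ∧ 0 < μ ∧ ∀ t, 0 ≤ t →
    LoewnerGE ((1 / δ) • matIntegral (fun s => proj (y s)) t (t + δ)) μ

/-- The state matrix `A(t)` of the error system. -/
def errorA {g : ℝ} (B : RigidMotion g) (t : ℝ) : Matrix (Fin 3 ⊕ Fin 3) (Fin 3 ⊕ Fin 3) ℝ :=
  Matrix.fromBlocks (-skew (B.ω t)) 1 0 (-skew (B.ω t))

/-- The output matrix `C(t)` of the error system. -/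
def errorC {g : ℝ} (B T : RigidMotion g) (t : ℝ) : Matrix (Fin 3) (Fin 3 ⊕ Fin 3) ℝ :=
  Matrix.fromCols (proj (bearing B T t)) 0

end

/-! ### Calculus of matrix-valued functions -/

section MatrixCalculus

variable {l m n : Type*}

/-! Observability. Rotating both halves of the state by `Q_B` turns `ẋ = A x` into a double
integrator, so in the inertial frame the position part moves along `v + (s - t) w`. Since rotations
are isometries, the output energy at time `s` is the squared length of this vector projected
orthogonally to the inertial bearing. Persistence of excitation bounds the energy of a constant
vector from below; applying it on two windows sufficiently far apart separates `v` from `w`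
(`PersistentlyExciting.exists_affine_bound`, `uniformlyObservable_error`).

Riccati equation. The flow linearizes as `P = X Y⁻¹` for a linear Hamiltonian system. The pairing
`Xv ⬝ Yv` is nondecreasing, which keeps `Y` invertible for all time; uniqueness is a Grönwall
estimate on the difference of two solutions.

Stability. Once `ε I ⪯ P ⪯ β I` uniformly in time, `x ⬝ P⁻¹ x` is a strict Lyapunov function. Both
bounds follow `z ⬝ P z` along a controlled adjoint system `ż = -Aᵀ z - Cᵀ u`: completing the square
gives `(z ⬝ P z)' ≤ z ⬝ S z + u ⬝ D⁻¹ u`. Observability allows `z` to be steered from `0` to any `w`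
at a cost at most a constant times `|w|²`, which bounds `w ⬝ P w` above without reference to the
past of `P`. A feedback choice of `u` makes `z ⬝ (P - ε) z` nondecreasing for small `ε`, giving the
lower bound. -/

lemma MatHasDerivWithinAt.mono {M : ℝ → Matrix m n ℝ} {M' : Matrix m n ℝ} {s u : Set ℝ} {t : ℝ}
    (h : MatHasDerivWithinAt M M' s t) (hu : u ⊆ s) : MatHasDerivWithinAt M M' u t :=
  fun i j => (h i j).mono hu

lemma MatHasDerivWithinAt.sub {M N : ℝ → Matrix m n ℝ} {M' N' : Matrix m n ℝ} {s : Set ℝ} {t : ℝ}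
    (hM : MatHasDerivWithinAt M M' s t) (hN : MatHasDerivWithinAt N N' s t) :
    MatHasDerivWithinAt (fun τ => M τ - N τ) (M' - N') s t :=
  fun i j => (hM i j).sub (hN i j)

lemma MatHasDerivWithinAt.const (M : Matrix m n ℝ) (s : Set ℝ) (t : ℝ) :
    MatHasDerivWithinAt (fun _ => M) 0 s t :=
  fun i j => hasDerivWithinAt_const t s (M i j)

lemma MatHasDerivWithinAt.transpose {M : ℝ → Matrix m n ℝ} {M' : Matrix m n ℝ} {s : Set ℝ} {t : ℝ}
    (hM : MatHasDerivWithinAt M M' s t) : MatHasDerivWithinAt (fun τ => (M τ)ᵀ) M'ᵀ s t :=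
  fun i j => hM j i

lemma MatHasDerivWithinAt.mul [Fintype m] {M : ℝ → Matrix l m ℝ} {N : ℝ → Matrix m n ℝ}
    {M' : Matrix l m ℝ} {N' : Matrix m n ℝ} {s : Set ℝ} {t : ℝ}
    (hM : MatHasDerivWithinAt M M' s t) (hN : MatHasDerivWithinAt N N' s t) :
    MatHasDerivWithinAt (fun τ => M τ * N τ) (M' * N t + M t * N') s t := by
  intro i j
  simp only [Matrix.mul_apply, Matrix.add_apply, ← Finset.sum_add_distrib]
  exact HasDerivWithinAt.fun_sum fun k _ => (hM i k).mul (hN k j)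

lemma MatHasDerivWithinAt.mulVec [Finite m] [Fintype n] {M : ℝ → Matrix m n ℝ} {x : ℝ → n → ℝ}
    {M' : Matrix m n ℝ} {x' : n → ℝ} {s : Set ℝ} {t : ℝ}
    (hM : MatHasDerivWithinAt M M' s t) (hx : HasDerivWithinAt x x' s t) :
    HasDerivWithinAt (fun τ => M τ *ᵥ x τ) (M' *ᵥ x t + M t *ᵥ x') s t := by
  have := Fintype.ofFinite m
  rw [hasDerivWithinAt_pi] at hx ⊢
  intro i
  simp only [Matrix.mulVec, dotProduct, Pi.add_apply, ← Finset.sum_add_distrib]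
  exact HasDerivWithinAt.fun_sum fun k _ => (hM i k).mul (hx k)

lemma HasDerivWithinAt.dotProduct [Fintype n] {x y : ℝ → n → ℝ} {x' y' : n → ℝ} {s : Set ℝ} {t : ℝ}
    (hx : HasDerivWithinAt x x' s t) (hy : HasDerivWithinAt y y' s t) :
    HasDerivWithinAt (fun τ => x τ ⬝ᵥ y τ) (x' ⬝ᵥ y t + x t ⬝ᵥ y') s t := by
  rw [hasDerivWithinAt_pi] at hx hy
  simp only [_root_.dotProduct, ← Finset.sum_add_distrib]
  exact HasDerivWithinAt.fun_sum fun k _ => (hx k).mul (hy k)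

lemma MatHasDerivWithinAt.continuousOn {M M' : ℝ → Matrix m n ℝ} {s : Set ℝ}
    (h : ∀ t ∈ s, MatHasDerivWithinAt M (M' t) s t) : ContinuousOn M s := by
  refine continuousOn_pi.2 fun i => continuousOn_pi.2 fun j => ?_
  exact fun t ht => (h t ht i j).continuousWithinAt

-- Links the entrywise derivative to the normed algebra of matrices, where the derivative of the
-- inverse and the vector-valued Grönwall lemmas live.
open scoped Matrix.Norms.Operator in
lemma matHasDerivWithinAt_iff [Fintype m] [Fintype n] {M : ℝ → Matrix m n ℝ} {M' : Matrix m n ℝ}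
    {s : Set ℝ} {t : ℝ} : MatHasDerivWithinAt M M' s t ↔ HasDerivWithinAt M M' s t := by
  let e : Matrix m n ℝ ≃ₗ[ℝ] (m → n → ℝ) := (Matrix.ofLinearEquiv ℝ).symm
  have key : HasDerivWithinAt M M' s t ↔ HasDerivWithinAt (fun τ => e (M τ)) (e M') s t := by
    constructor
    · intro h
      exact e.toContinuousLinearEquiv.hasFDerivAt.comp_hasDerivWithinAt t h
    · intro h
      exact e.symm.toContinuousLinearEquiv.hasFDerivAt.comp_hasDerivWithinAt t h
  rw [key, hasDerivWithinAt_pi]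
  simp only [hasDerivWithinAt_pi]
  rfl

open scoped Matrix.Norms.Operator in
lemma MatHasDerivWithinAt.inv [Fintype n] [DecidableEq n] {M : ℝ → Matrix n n ℝ}
    {M' : Matrix n n ℝ} {s : Set ℝ} {t : ℝ} (hM : MatHasDerivWithinAt M M' s t)
    (hdet : IsUnit (M t)) :
    MatHasDerivWithinAt (fun τ => (M τ)⁻¹) (-((M t)⁻¹ * M' * (M t)⁻¹)) s t := by
  rw [matHasDerivWithinAt_iff] at hM ⊢
  obtain ⟨u, hu⟩ := hdet
  have h := hasFDerivAt_ringInverse (𝕜 := ℝ) u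
  rw [hu] at h
  have h2 := h.comp_hasDerivWithinAt t hM
  have e : (-(ContinuousLinearMap.mulLeftRight ℝ (Matrix n n ℝ)) ↑u⁻¹ ↑u⁻¹) M'
      = -((M t)⁻¹ * M' * (M t)⁻¹) := by
    rw [← hu]
    simp [Matrix.coe_units_inv]
  rw [e] at h2
  have hfun : (fun τ => (M τ)⁻¹) = Ring.inverse ∘ M :=
    funext fun τ => Matrix.nonsing_inv_eq_ringInverse (M τ)
  rw [hfun]
  exact h2

lemma ContinuousOn.matrix_mul [Fintype m] {X : Type*} [TopologicalSpace X] {M : X → Matrix l m ℝ}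
    {N : X → Matrix m n ℝ} {s : Set X} (hM : ContinuousOn M s) (hN : ContinuousOn N s) :
    ContinuousOn (fun t => M t * N t) s := by
  rw [continuousOn_iff_continuous_domRestrict] at *
  exact Continuous.matrix_mul hM hN

lemma ContinuousOn.matrix_mulVec [Fintype n] {X : Type*} [TopologicalSpace X]
    {M : X → Matrix m n ℝ} {x : X → n → ℝ} {s : Set X} (hM : ContinuousOn M s)
    (hx : ContinuousOn x s) : ContinuousOn (fun t => M t *ᵥ x t) s := by
  rw [continuousOn_iff_continuous_domRestrict] at *
  exact Continuous.matrix_mulVec hM hx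

lemma ContinuousOn.matrix_transpose {X : Type*} [TopologicalSpace X]
    {M : X → Matrix m n ℝ} {s : Set X} (hM : ContinuousOn M s) :
    ContinuousOn (fun t => (M t)ᵀ) s := by
  rw [continuousOn_iff_continuous_domRestrict] at *
  exact Continuous.matrix_transpose hM

end MatrixCalculus

lemma le_of_hasDerivWithinAt_nonneg {f f' : ℝ → ℝ} {a b : ℝ} (hab : a ≤ b)
    (hf : ∀ t ∈ Icc a b, HasDerivWithinAt f (f' t) (Icc a b) t)
    (hf' : ∀ t ∈ Icc a b, 0 ≤ f' t) : f a ≤ f b := by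
  have hmono : MonotoneOn f (Icc a b) := by
    refine monotoneOn_of_hasDerivWithinAt_nonneg (convex_Icc a b)
      (fun t ht => (hf t ht).continuousWithinAt) (f' := f') ?_ ?_
    · intro t ht
      exact (hf t (interior_subset ht)).mono interior_subset
    · exact fun t ht => hf' t (interior_subset ht)
  exact hmono (left_mem_Icc.2 hab) (right_mem_Icc.2 hab) hab

/-! ### Linear differential equations with continuous coefficients -/

section LinearODE

open scoped Matrix.Norms.Operator

variable {n : Type*} [Fintype n]

lemma exists_norm_le_of_continuousOn_Icc {E : Type*} [SeminormedAddCommGroup E] {F : ℝ → E}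
    {a b : ℝ} (hF : ContinuousOn F (Icc a b)) : ∃ K, 0 ≤ K ∧ ∀ t ∈ Icc a b, ‖F t‖ ≤ K := by
  obtain ⟨K, hK⟩ := isCompact_Icc.exists_bound_of_continuousOn hF
  exact ⟨max K 0, le_max_right _ _, fun t ht => (hK t ht).trans (le_max_left _ _)⟩

/-- Truncation of the coordinates of a vector to `[-R, R]`. -/
noncomputable def clipVec (R : ℝ) (x : n → ℝ) : n → ℝ := fun i => max (-R) (min R (x i))

lemma norm_clipVec_sub_le (R : ℝ) (x y : n → ℝ) : ‖clipVec R x - clipVec R y‖ ≤ ‖x - y‖ := by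
  refine (pi_norm_le_iff_of_nonneg (norm_nonneg _)).2 fun i => ?_
  refine le_trans ?_ (norm_le_pi_norm (x - y) i)
  simp only [clipVec, Pi.sub_apply, Real.norm_eq_abs]
  calc |max (-R) (min R (x i)) - max (-R) (min R (y i))|
      ≤ |min R (x i) - min R (y i)| := by
        simpa using abs_max_sub_max_le_max (-R) (min R (x i)) (-R) (min R (y i))
    _ ≤ |x i - y i| := by
        simpa using abs_min_sub_min_le_max R (x i) R (y i)

lemma norm_clipVec_le {R : ℝ} (hR : 0 ≤ R) (x : n → ℝ) : ‖clipVec R x‖ ≤ R := by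
  refine (pi_norm_le_iff_of_nonneg hR).2 fun i => ?_
  rw [Real.norm_eq_abs, abs_le, clipVec]
  exact ⟨le_max_left _ _, max_le (by linarith) (min_le_left _ _)⟩

lemma norm_clipVec_le_norm {R : ℝ} (hR : 0 ≤ R) (x : n → ℝ) : ‖clipVec R x‖ ≤ ‖x‖ := by
  have h0 : clipVec R (0 : n → ℝ) = 0 := by
    ext i
    simp [clipVec, hR]
  simpa [h0] using norm_clipVec_sub_le R x 0

lemma clipVec_eq_self {R : ℝ} {x : n → ℝ} (hx : ‖x‖ ≤ R) : clipVec R x = x := by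
  ext i
  have h := abs_le.1 ((norm_le_pi_norm x i).trans hx)
  rw [clipVec, min_eq_right h.2, max_eq_right h.1]

/-- Picard–Lindelöf over the whole interval needs a bounded vector field, so the state is clipped at
the radius `R` that Grönwall predicts. The clipped field still grows at most linearly with constant
`K`, hence its solution stays within `R` and the clipping is inactive. -/
lemma exists_linearODE_solution_Icc {F : ℝ → Matrix n n ℝ} {t₀ T : ℝ} (hT : 0 ≤ T)
    (hF : ContinuousOn F (Icc t₀ (t₀ + T))) (x₀ : n → ℝ) :
    ∃ x : ℝ → n → ℝ, x t₀ = x₀ ∧ ∀ t ∈ Icc t₀ (t₀ + T),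
      HasDerivWithinAt x (F t *ᵥ x t) (Icc t₀ (t₀ + T)) t := by
  obtain ⟨K, hK0, hK⟩ := exists_norm_le_of_continuousOn_Icc hF
  set R : ℝ := ‖x₀‖ * Real.exp (K * T) with hR
  have hR0 : 0 ≤ R := by positivity
  have hPL : IsPicardLindelof (fun t x => F t *ᵥ clipVec R x)
      (⟨t₀, left_mem_Icc.2 (by linarith)⟩ : Icc t₀ (t₀ + T)) x₀ (K * R * T).toNNReal 0
      (K * R).toNNReal K.toNNReal := by
    refine ⟨?_, ?_, ?_, ?_⟩
    · intro t ht
      refine LipschitzOnWith.of_dist_le_mul fun x _ y _ => ?_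
      rw [dist_eq_norm, dist_eq_norm, ← Matrix.mulVec_sub, Real.coe_toNNReal _ hK0]
      exact (Matrix.linfty_opNorm_mulVec _ _).trans
        (mul_le_mul (hK t ht) (norm_clipVec_sub_le R x y) (norm_nonneg _) hK0)
    · intro x _
      exact hF.matrix_mulVec continuousOn_const
    · intro t ht x _
      rw [Real.coe_toNNReal _ (by positivity)]
      exact (Matrix.linfty_opNorm_mulVec _ _).trans
        (mul_le_mul (hK t ht) (norm_clipVec_le hR0 x) (norm_nonneg _) hK0)
    · rw [Real.coe_toNNReal _ (by positivity), Real.coe_toNNReal _ (by positivity)]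
      simp [hT]
  obtain ⟨x, hx0, hx⟩ := hPL.exists_eq_forall_mem_Icc_hasDerivWithinAt₀
  refine ⟨x, hx0, fun t ht => ?_⟩
  have hbound : ‖x t‖ ≤ R := by
    have := norm_le_gronwallBound_of_norm_deriv_right_le (f := x)
      (f' := fun t => F t *ᵥ clipVec R (x t)) (δ := ‖x₀‖) (K := K) (ε := 0) (a := t₀) (b := t₀ + T)
      (fun t ht => (hx t ht).continuousWithinAt)
      (fun t ht => (hx t (Ico_subset_Icc_self ht)).mono_of_mem_nhdsWithin
        (Icc_mem_nhdsGE_of_mem ht)) (by simp [← hx0]) (fun t ht => by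
          rw [add_zero]
          exact (Matrix.linfty_opNorm_mulVec _ _).trans
            (mul_le_mul (hK t (Ico_subset_Icc_self ht)) (norm_clipVec_le_norm hR0 _)
              (norm_nonneg _) hK0)) t ht
    rw [gronwallBound_ε0] at this
    refine this.trans (mul_le_mul_of_nonneg_left (Real.exp_le_exp.2 ?_) (norm_nonneg _))
    exact mul_le_mul_of_nonneg_left (by linarith [ht.2]) hK0
  have h := hx t ht
  rwa [clipVec_eq_self hbound] at h

lemma eqOn_of_linearODE {F : ℝ → Matrix n n ℝ} {a b : ℝ} (hF : ContinuousOn F (Icc a b))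
    {x y : ℝ → n → ℝ} (hx : ∀ t ∈ Icc a b, HasDerivWithinAt x (F t *ᵥ x t) (Icc a b) t)
    (hy : ∀ t ∈ Icc a b, HasDerivWithinAt y (F t *ᵥ y t) (Icc a b) t) (hxy : x a = y a) :
    EqOn x y (Icc a b) := by
  obtain ⟨K, hK0, hK⟩ := exists_norm_le_of_continuousOn_Icc hF
  intro t ht
  have := eq_zero_of_abs_deriv_le_mul_abs_self_of_eq_zero_right (f := fun t => x t - y t)
    (f' := fun t => F t *ᵥ x t - F t *ᵥ y t) (K := K) (a := a) (b := b)
    (fun t ht => ((hx t ht).sub (hy t ht)).continuousWithinAt)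
    (fun t ht => ((hx t (Ico_subset_Icc_self ht)).sub
      (hy t (Ico_subset_Icc_self ht))).mono_of_mem_nhdsWithin (Icc_mem_nhdsGE_of_mem ht))
    (by simp [hxy]) (fun t ht => by
      rw [← Matrix.mulVec_sub]
      exact (Matrix.linfty_opNorm_mulVec _ _).trans
        (mul_le_mul_of_nonneg_right (hK t (Ico_subset_Icc_self ht)) (norm_nonneg _))) t ht
  exact sub_eq_zero.1 this

/-- Solutions on the intervals `[t₀, t₀ + N]` agree on overlaps by uniqueness and are glued. -/
theorem exists_isLinearSolution {F : ℝ → Matrix n n ℝ} {t₀ : ℝ} (hF : ContinuousOn F (Ici t₀))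
    (x₀ : n → ℝ) : ∃ x, IsLinearSolution F t₀ x ∧ x t₀ = x₀ := by
  have hF' : ∀ N : ℕ, ContinuousOn F (Icc t₀ (t₀ + N)) := fun N => hF.mono Icc_subset_Ici_self
  choose x hx0 hx using fun N : ℕ => exists_linearODE_solution_Icc (Nat.cast_nonneg N) (hF' N) x₀
  have hcons : ∀ N M : ℕ, N ≤ M → EqOn (x M) (x N) (Icc t₀ (t₀ + N)) := by
    intro N M hNM
    have hsub : Icc t₀ (t₀ + N) ⊆ Icc t₀ (t₀ + (M : ℝ)) :=
      Icc_subset_Icc_right (by have : (N : ℝ) ≤ M := Nat.cast_le.2 hNM; linarith)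
    exact eqOn_of_linearODE (hF' N) (fun t ht => (hx M t (hsub ht)).mono hsub) (hx N)
      ((hx0 M).trans (hx0 N).symm)
  set y : ℝ → n → ℝ := fun t => x (⌈t - t₀⌉₊ + 1) t with hy
  have hyx : ∀ N : ℕ, ∀ t ∈ Icc t₀ (t₀ + N), y t = x N t := by
    intro N t ht
    have h1 : t ∈ Icc t₀ (t₀ + (⌈t - t₀⌉₊ + 1 : ℕ)) := by
      refine ⟨ht.1, ?_⟩
      have := Nat.le_ceil (t - t₀)
      push_cast
      linarith
    rcases le_total N (⌈t - t₀⌉₊ + 1) with h | h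
    · exact hcons _ _ h ht
    · exact (hcons _ _ h h1).symm
  refine ⟨y, fun t ht => ?_, ?_⟩
  · obtain ⟨N, hN⟩ := exists_nat_gt (t - t₀)
    have htN : t ∈ Icc t₀ (t₀ + N) := ⟨ht, by linarith⟩
    have hmem : Icc t₀ (t₀ + N) ∈ nhdsWithin t (Ici t₀) := by
      rw [← Ici_inter_Iic]
      exact inter_mem_nhdsWithin _ (Iic_mem_nhds (by linarith))
    have h := ((hx N t htN).congr (hyx N) (hyx N t htN)).mono_of_mem_nhdsWithin hmem
    rwa [← hyx N t htN] at h
  · rw [hyx 0 t₀ (by simp), hx0]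

/-- Solutions of `ẋ = F(t) x` with prescribed terminal value. -/
theorem exists_linearODE_solution_of_terminal {F : ℝ → Matrix n n ℝ} {a b : ℝ} (hab : a ≤ b)
    (hF : ContinuousOn F (Icc a b)) (w : n → ℝ) :
    ∃ z : ℝ → n → ℝ, z b = w ∧
      ∀ t ∈ Icc a b, HasDerivWithinAt z (F t *ᵥ z t) (Icc a b) t := by
  have hmaps : MapsTo (fun s => b - s) (Icc 0 (0 + (b - a))) (Icc a b) := by
    intro s hs
    constructor <;> linarith [hs.1, hs.2]
  have hmaps' : MapsTo (fun s => b - s) (Icc a b) (Icc 0 (0 + (b - a))) := by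
    intro s hs
    constructor <;> linarith [hs.1, hs.2]
  have hG : ContinuousOn (fun s => -F (b - s)) (Icc 0 (0 + (b - a))) :=
    (hF.comp (by fun_prop) hmaps).neg
  -- Reversing time by `t ↦ b - t` makes the terminal value an initial value.
  obtain ⟨y, hy0, hy⟩ := exists_linearODE_solution_Icc (sub_nonneg.2 hab) hG w
  refine ⟨fun t => y (b - t), by simp [hy0], fun t ht => ?_⟩
  have h1 : HasDerivWithinAt (fun t : ℝ => b - t) (-1) (Icc a b) t := by
    simpa using (hasDerivWithinAt_id t (Icc a b)).const_sub b
  have h2 := (hy (b - t) (hmaps' ht)).scomp t h1 hmaps'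
  simpa [Matrix.neg_mulVec, Function.comp_def] using h2

end LinearODE

/-! ### Quadratic forms -/

section QuadraticForms

variable {m n : Type*} [Fintype m] [Fintype n]

lemma dotProduct_transpose_mulVec_eq (M : Matrix m n ℝ) (x : n → ℝ) (y : m → ℝ) :
    x ⬝ᵥ (Mᵀ *ᵥ y) = (M *ᵥ x) ⬝ᵥ y := by
  rw [Matrix.dotProduct_mulVec, Matrix.vecMul_transpose]

lemma dotProduct_conj_mulVec (C : Matrix m n ℝ) (D : Matrix m m ℝ) (x : n → ℝ) :
    x ⬝ᵥ ((Cᵀ * D * C) *ᵥ x) = (C *ᵥ x) ⬝ᵥ (D *ᵥ (C *ᵥ x)) := by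
  rw [← Matrix.mulVec_mulVec, ← Matrix.mulVec_mulVec, dotProduct_transpose_mulVec_eq]

lemma posSemidef_iff_transpose_eq_and_dotProduct_nonneg {M : Matrix n n ℝ} :
    M.PosSemidef ↔ Mᵀ = M ∧ ∀ x, 0 ≤ x ⬝ᵥ (M *ᵥ x) := by
  rw [Matrix.posSemidef_iff_dotProduct_mulVec, Matrix.IsHermitian,
    Matrix.conjTranspose_eq_transpose_of_trivial]
  simp

variable [DecidableEq n]

lemma loewnerGE_iff {M : Matrix n n ℝ} {c : ℝ} :
    LoewnerGE M c ↔ Mᵀ = M ∧ ∀ x, c * (x ⬝ᵥ x) ≤ x ⬝ᵥ (M *ᵥ x) := by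
  rw [LoewnerGE, posSemidef_iff_transpose_eq_and_dotProduct_nonneg]
  simp [Matrix.sub_mulVec, Matrix.smul_mulVec, dotProduct_sub]

lemma IsWeight.exists_bounds {S : ℝ → Matrix n n ℝ} (hS : IsWeight S) :
    ∃ a b : ℝ, 0 < a ∧ 0 < b ∧ ∀ t, 0 ≤ t → (S t)ᵀ = S t ∧ ∀ x,
      a * (x ⬝ᵥ x) ≤ x ⬝ᵥ (S t *ᵥ x) ∧ x ⬝ᵥ (S t *ᵥ x) ≤ b * (x ⬝ᵥ x) := by
  obtain ⟨-, a, b, ha, h⟩ := hS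
  refine ⟨a, max b 1, ha, by positivity, fun t ht => ?_⟩
  obtain ⟨h1, h2⟩ := h t ht
  rw [loewnerGE_iff] at h1
  refine ⟨h1.1, fun x => ⟨h1.2 x, ?_⟩⟩
  have h3 := (posSemidef_iff_transpose_eq_and_dotProduct_nonneg.1 h2).2 x
  simp only [Matrix.sub_mulVec, Matrix.smul_mulVec, dotProduct_sub, Matrix.one_mulVec,
    dotProduct_smul, smul_eq_mul] at h3
  have h4 : b * (x ⬝ᵥ x) ≤ max b 1 * (x ⬝ᵥ x) :=
    mul_le_mul_of_nonneg_right (le_max_left _ _) (by simpa using dotProduct_star_self_nonneg x)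
  linarith

end QuadraticForms

/-! ### The Riccati equation: existence and uniqueness -/

section Riccati

variable {m n : Type*} [Fintype m] [Fintype n]
  {A : ℝ → Matrix n n ℝ} {C : ℝ → Matrix m n ℝ} {D : ℝ → Matrix m m ℝ} {S : ℝ → Matrix n n ℝ}

lemma IsRiccatiSolution.continuousOn {P : ℝ → Matrix n n ℝ} (hP : IsRiccatiSolution A C D S P) :
    ContinuousOn P (Ici 0) :=
  MatHasDerivWithinAt.continuousOn hP

open scoped Matrix.Norms.Operator in
theorem IsRiccatiSolution.eqOn {P P' : ℝ → Matrix n n ℝ} (hA : ContinuousOn A (Ici 0))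
    (hC : ContinuousOn C (Ici 0)) (hD : ContinuousOn D (Ici 0))
    (hP : IsRiccatiSolution A C D S P) (hP' : IsRiccatiSolution A C D S P') (h0 : P 0 = P' 0) :
    EqOn P P' (Ici 0) := by
  intro T hT
  have hG : ContinuousOn (fun t => (C t)ᵀ * D t * C t) (Ici 0) :=
    (hC.matrix_transpose.matrix_mul hD).matrix_mul hC
  have hcont : ContinuousOn (fun t => ‖A t‖ + ‖(A t)ᵀ‖ + ‖(C t)ᵀ * D t * C t * P t‖ +
      ‖P' t * ((C t)ᵀ * D t * C t)‖) (Icc 0 T) :=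
    (((hA.norm.add hA.matrix_transpose.norm).add (hG.matrix_mul hP.continuousOn).norm).add
      (hP'.continuousOn.matrix_mul hG).norm).mono Icc_subset_Ici_self
  obtain ⟨K, -, hK⟩ := exists_norm_le_of_continuousOn_Icc hcont
  have hder : ∀ t ∈ Ici (0 : ℝ), HasDerivWithinAt (fun t => P t - P' t) _ (Ici 0) t := fun t ht =>
    matHasDerivWithinAt_iff.1 ((hP t ht).sub (hP' t ht))
  have := eq_zero_of_abs_deriv_le_mul_abs_self_of_eq_zero_right (f := fun t => P t - P' t)
    (K := K) (a := 0) (b := T)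
    (fun t ht => (hder t ht.1).continuousWithinAt.mono Icc_subset_Ici_self)
    (fun t ht => (hder t ht.1).mono (Ici_subset_Ici.2 ht.1))
    (by simp [h0]) (fun t ht => ?_) T (right_mem_Icc.2 hT)
  · exact sub_eq_zero.1 this
  · have hb := hK t (Ico_subset_Icc_self ht)
    rw [Real.norm_of_nonneg (by positivity)] at hb
    set G := (C t)ᵀ * D t * C t with hGdef
    set E := P t - P' t with hE
    -- The quadratic terms differ by `P G P - P' G P' = E G P + P' G E`, so `E` obeys a linear
    -- equation with coefficients bounded on `[0, T]`.
    have heq : A t * P t + P t * (A t)ᵀ - P t * (C t)ᵀ * D t * C t * P t + S t -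
        (A t * P' t + P' t * (A t)ᵀ - P' t * (C t)ᵀ * D t * C t * P' t + S t) =
        A t * E + E * (A t)ᵀ - E * (G * P t) - P' t * G * E := by
      have e : ∀ N : Matrix n n ℝ, N * (C t)ᵀ * D t * C t * N = N * G * N := fun N => by
        simp only [hGdef, Matrix.mul_assoc]
      rw [hE, e, e]
      noncomm_ring
    rw [heq]
    calc ‖A t * E + E * (A t)ᵀ - E * (G * P t) - P' t * G * E‖
        ≤ ‖A t * E‖ + ‖E * (A t)ᵀ‖ + ‖E * (G * P t)‖ + ‖P' t * G * E‖ :=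
          (norm_sub_le _ _).trans (add_le_add_left ((norm_sub_le _ _).trans
            (add_le_add_left (norm_add_le _ _) _)) _)
      _ ≤ ‖A t‖ * ‖E‖ + ‖E‖ * ‖(A t)ᵀ‖ + ‖E‖ * ‖G * P t‖ + ‖P' t * G‖ * ‖E‖ := by
          gcongr <;> exact Matrix.linfty_opNorm_mul _ _
      _ = (‖A t‖ + ‖(A t)ᵀ‖ + ‖G * P t‖ + ‖P' t * G‖) * ‖E‖ := by ring
      _ ≤ K * ‖E‖ := by gcongr

/-- The solution of a Riccati equation with symmetric coefficients is symmetric. -/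
theorem IsRiccatiSolution.transpose_eq {P : ℝ → Matrix n n ℝ} (hA : ContinuousOn A (Ici 0))
    (hC : ContinuousOn C (Ici 0)) (hD : ContinuousOn D (Ici 0))
    (hDs : ∀ t, 0 ≤ t → (D t)ᵀ = D t) (hSs : ∀ t, 0 ≤ t → (S t)ᵀ = S t)
    (hP : IsRiccatiSolution A C D S P) (h0 : (P 0)ᵀ = P 0) :
    ∀ t, 0 ≤ t → (P t)ᵀ = P t := by
  have hPt : IsRiccatiSolution A C D S fun t => (P t)ᵀ := by
    intro t ht
    have h := (hP t ht).transpose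
    convert h using 1
    simp only [Matrix.transpose_add, Matrix.transpose_sub, Matrix.transpose_mul,
      Matrix.transpose_transpose, hDs t ht, hSs t ht, Matrix.mul_assoc]
    abel
  exact fun t ht => hPt.eqOn hA hC hD hP h0 ht

/-- Solutions of the linear matrix system `Ẏ = F₁₁ Y + F₁₂ X`, `Ẋ = F₂₁ Y + F₂₂ X`. -/
lemma exists_blockLinear_solution {F₁₁ F₁₂ F₂₁ F₂₂ : ℝ → Matrix n n ℝ} {t₀ : ℝ}
    (h₁₁ : ContinuousOn F₁₁ (Ici t₀)) (h₁₂ : ContinuousOn F₁₂ (Ici t₀))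
    (h₂₁ : ContinuousOn F₂₁ (Ici t₀)) (h₂₂ : ContinuousOn F₂₂ (Ici t₀)) (Y₀ X₀ : Matrix n n ℝ) :
    ∃ Y X : ℝ → Matrix n n ℝ, Y t₀ = Y₀ ∧ X t₀ = X₀ ∧
      (∀ t, t₀ ≤ t → MatHasDerivWithinAt Y (F₁₁ t * Y t + F₁₂ t * X t) (Ici t₀) t) ∧
      ∀ t, t₀ ≤ t → MatHasDerivWithinAt X (F₂₁ t * Y t + F₂₂ t * X t) (Ici t₀) t := by
  have hH : ContinuousOn
      (fun t => Matrix.fromBlocks (F₁₁ t) (F₁₂ t) (F₂₁ t) (F₂₂ t)) (Ici t₀) := by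
    rw [continuousOn_iff_continuous_domRestrict] at *
    exact Continuous.matrix_fromBlocks h₁₁ h₁₂ h₂₁ h₂₂
  choose z hz hz0 using fun j : n =>
    exists_isLinearSolution hH (Sum.elim (fun i => Y₀ i j) fun i => X₀ i j)
  refine ⟨fun t => Matrix.of fun i j => z j t (Sum.inl i),
    fun t => Matrix.of fun i j => z j t (Sum.inr i), ?_, ?_, ?_, ?_⟩
  · ext i j
    simp [hz0]
  · ext i j
    simp [hz0]
  · intro t ht i j
    refine (hasDerivWithinAt_pi.1 (hz j t ht) (Sum.inl i)).congr_deriv ?_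
    simp only [Matrix.mulVec, dotProduct, Fintype.sum_sum_type, Matrix.fromBlocks_apply₁₁,
      Matrix.fromBlocks_apply₁₂, Matrix.add_apply, Matrix.mul_apply, Matrix.of_apply]
  · intro t ht i j
    refine (hasDerivWithinAt_pi.1 (hz j t ht) (Sum.inr i)).congr_deriv ?_
    simp only [Matrix.mulVec, dotProduct, Fintype.sum_sum_type, Matrix.fromBlocks_apply₂₁,
      Matrix.fromBlocks_apply₂₂, Matrix.add_apply, Matrix.mul_apply, Matrix.of_apply]

/-- Existence of solutions of the Riccati equation on `[0, ∞)`, through the linear Hamiltonian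
system `Ẏ = -Aᵀ Y + Cᵀ D C X`, `Ẋ = S Y + A X` and `P = X Y⁻¹`. -/
theorem exists_isRiccatiSolution [DecidableEq n] (hA : ContinuousOn A (Ici 0))
    (hC : ContinuousOn C (Ici 0)) (hD : ContinuousOn D (Ici 0)) (hS : ContinuousOn S (Ici 0))
    (hDpos : ∀ t, 0 ≤ t → ∀ x, 0 ≤ x ⬝ᵥ (D t *ᵥ x))
    (hSpos : ∀ t, 0 ≤ t → ∀ x, 0 ≤ x ⬝ᵥ (S t *ᵥ x))
    {P₀ : Matrix n n ℝ} (hP₀ : ∀ x, x ≠ 0 → 0 < x ⬝ᵥ (P₀ *ᵥ x)) :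
    ∃ P, IsRiccatiSolution A C D S P ∧ P 0 = P₀ := by
  have hG : ContinuousOn (fun t => (C t)ᵀ * D t * C t) (Ici 0) :=
    (hC.matrix_transpose.matrix_mul hD).matrix_mul hC
  obtain ⟨Y, X, hY0, hX0, hYd, hXd⟩ :=
    exists_blockLinear_solution (F₁₁ := fun t => -(A t)ᵀ) hA.matrix_transpose.neg hG hS hA 1 P₀
  -- The `A` terms cancel in the derivative of `Xv ⬝ Yv`, leaving `Yv ⬝ S Yv + CXv ⬝ D CXv ≥ 0`; the
  -- initial value is `v ⬝ P₀ v`. A kernel vector of `Y` would make the pairing vanish.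
  have hpos : ∀ t, 0 ≤ t → ∀ v, v ≠ 0 → 0 < (X t *ᵥ v) ⬝ᵥ (Y t *ᵥ v) := by
    intro t ht v hv
    have hle : (X 0 *ᵥ v) ⬝ᵥ (Y 0 *ᵥ v) ≤ (X t *ᵥ v) ⬝ᵥ (Y t *ᵥ v) := by
      refine le_of_hasDerivWithinAt_nonneg (f := fun t => (X t *ᵥ v) ⬝ᵥ (Y t *ᵥ v)) ht
        (fun s hs => (((hXd s hs.1).mulVec (hasDerivWithinAt_const s _ v)).dotProduct
          ((hYd s hs.1).mulVec (hasDerivWithinAt_const s _ v))).mono Icc_subset_Ici_self) ?_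
      intro s hs
      have e1 : (X s *ᵥ v) ⬝ᵥ ((A s)ᵀ *ᵥ (Y s *ᵥ v)) = (A s *ᵥ (X s *ᵥ v)) ⬝ᵥ (Y s *ᵥ v) :=
        dotProduct_transpose_mulVec_eq _ _ _
      have e2 := hDpos s hs.1 (C s *ᵥ (X s *ᵥ v))
      rw [← dotProduct_conj_mulVec] at e2
      have e3 := hSpos s hs.1 (Y s *ᵥ v)
      rw [dotProduct_comm] at e3
      simp only [Matrix.mulVec_zero, add_zero, Matrix.add_mulVec, ← Matrix.mulVec_mulVec,
        add_dotProduct, dotProduct_add, Matrix.neg_mulVec, dotProduct_neg] at e1 e2 e3 ⊢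
      linarith
    refine lt_of_lt_of_le ?_ hle
    rw [hX0, hY0, Matrix.one_mulVec, dotProduct_comm]
    exact hP₀ v hv
  have hunit : ∀ t, 0 ≤ t → IsUnit (Y t) := by
    intro t ht
    rw [← Matrix.mulVec_injective_iff_isUnit]
    refine (injective_iff_map_eq_zero (Y t).mulVecLin).2 fun v hv => ?_
    by_contra hne
    have h := hpos t ht v hne
    rw [show Y t *ᵥ v = 0 from hv, dotProduct_zero] at h
    exact lt_irrefl _ h
  refine ⟨fun t => X t * (Y t)⁻¹, fun t ht => ?_, by simp [hX0, hY0]⟩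
  have h := (hXd t ht).mul ((hYd t ht).inv (hunit t ht))
  have hYY : Y t * (Y t)⁻¹ = 1 := Matrix.mul_nonsing_inv _ ((Matrix.isUnit_iff_isUnit_det _).1
    (hunit t ht))
  convert h using 1
  have e (N : Matrix n n ℝ) :
      N * (C t)ᵀ * D t * C t * N = N * ((C t)ᵀ * D t * C t) * N := by
    simp only [Matrix.mul_assoc]
  rw [e]
  generalize (C t)ᵀ * D t * C t = G
  have e₁ : (Y t)⁻¹ * (-(A t)ᵀ * Y t + G * X t) * (Y t)⁻¹ =
      -((Y t)⁻¹ * (A t)ᵀ * (Y t * (Y t)⁻¹)) + (Y t)⁻¹ * G * X t * (Y t)⁻¹ := by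
    noncomm_ring
  have e₂ : (S t * Y t + A t * X t) * (Y t)⁻¹ = S t * (Y t * (Y t)⁻¹) + A t * X t * (Y t)⁻¹ := by
    noncomm_ring
  rw [e₁, e₂, hYY]
  noncomm_ring

end Riccati

/-! ### Uniform bounds for the Riccati equation -/

section Scalar

/-- A Grönwall inequality for scalar differential inequalities. -/
lemma le_mul_exp_of_hasDerivWithinAt_le {f f' : ℝ → ℝ} {a b k : ℝ} (hab : a ≤ b)
    (hf : ∀ t ∈ Icc a b, HasDerivWithinAt f (f' t) (Icc a b) t)
    (hf' : ∀ t ∈ Icc a b, f' t ≤ k * f t) : f b ≤ f a * Real.exp (k * (b - a)) := by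
  have hexp : ∀ t, HasDerivWithinAt (fun t => Real.exp (-k * (t - a)))
      (Real.exp (-k * (t - a)) * -k) (Icc a b) t := fun t => by
    have := (((hasDerivAt_id t).sub_const a).const_mul (-k)).exp
    simpa using this.hasDerivWithinAt
  have h := le_of_hasDerivWithinAt_nonneg (f := fun t => -(Real.exp (-k * (t - a)) * f t)) hab
    (fun t ht => ((hexp t).mul (hf t ht)).neg) (fun t ht => by
      have h1 := mul_le_mul_of_nonneg_left (hf' t ht) (Real.exp_nonneg (-k * (t - a)))
      linarith)
  have h2 : Real.exp (-k * (b - a)) * f b ≤ f a := by simpa using h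
  calc f b = Real.exp (k * (b - a)) * (Real.exp (-k * (b - a)) * f b) := by
        rw [← mul_assoc, ← Real.exp_add]
        simp
    _ ≤ Real.exp (k * (b - a)) * f a := mul_le_mul_of_nonneg_left h2 (Real.exp_nonneg _)
    _ = f a * Real.exp (k * (b - a)) := mul_comm _ _

lemma le_mul_exp_of_hasDerivWithinAt_le_add {f f' : ℝ → ℝ} {a b k c : ℝ} (hab : a ≤ b)
    (hk : 1 ≤ k) (hc : 0 ≤ c)
    (hf : ∀ t ∈ Icc a b, HasDerivWithinAt f (f' t) (Icc a b) t)
    (hf' : ∀ t ∈ Icc a b, f' t ≤ k * f t + c) :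
    f b ≤ (f a + c) * Real.exp (k * (b - a)) := by
  have h := le_mul_exp_of_hasDerivWithinAt_le (f := fun t => f t + c) (f' := f') (k := k) hab
    (fun t ht => (hf t ht).add_const c) (fun t ht => by nlinarith [hf' t ht])
  linarith

lemma real_dotProduct_self_nonneg {n : Type*} [Fintype n] (x : n → ℝ) : 0 ≤ x ⬝ᵥ x := by
  simpa using dotProduct_star_self_nonneg x

end Scalar

/-! ### Quadratic-form estimates and the lower bound on the Riccati solution -/

section Bounds

variable {m n : Type*} [Fintype m] [Fintype n]

lemma two_mul_dotProduct_le {c : ℝ} (hc : 0 < c) (x y : n → ℝ) :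
    2 * (x ⬝ᵥ y) ≤ c * (x ⬝ᵥ x) + c⁻¹ * (y ⬝ᵥ y) := by
  have h := mul_nonneg (inv_nonneg.2 hc.le) (real_dotProduct_self_nonneg (c • x - y))
  simp only [sub_dotProduct, dotProduct_sub, smul_dotProduct, dotProduct_smul, smul_eq_mul,
    dotProduct_comm y x] at h
  have e : c⁻¹ * (c * (c * (x ⬝ᵥ x)) - c * (x ⬝ᵥ y) - (c * (x ⬝ᵥ y) - y ⬝ᵥ y)) =
      c * (x ⬝ᵥ x) + c⁻¹ * (y ⬝ᵥ y) - 2 * (x ⬝ᵥ y) := by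
    field_simp
    ring
  linarith

lemma dotProduct_mulVec_le_of_abs_entry_le {M : Matrix n n ℝ} {K : ℝ}
    (hM : ∀ i j, |M i j| ≤ K) (x : n → ℝ) :
    x ⬝ᵥ (M *ᵥ x) ≤ K * Fintype.card n * (x ⬝ᵥ x) := by
  have h1 : ∀ i j, x i * (M i j * x j) ≤ K * ((x i * x i + x j * x j) / 2) := fun i j => by
    have h2 : x i * (M i j * x j) ≤ |M i j| * |x i * x j| := by
      rw [← abs_mul]
      exact (le_of_eq (by ring)).trans (le_abs_self _)
    have h3 : |x i * x j| ≤ (x i * x i + x j * x j) / 2 := by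
      rw [abs_le]
      constructor <;> nlinarith [sq_nonneg (x i + x j), sq_nonneg (x i - x j)]
    exact h2.trans (mul_le_mul (hM i j) h3 (abs_nonneg _) ((abs_nonneg _).trans (hM i j)))
  calc x ⬝ᵥ (M *ᵥ x) = ∑ i, ∑ j, x i * (M i j * x j) := by
        simp only [Matrix.mulVec, dotProduct, Finset.mul_sum]
    _ ≤ ∑ i, ∑ j, K * ((x i * x i + x j * x j) / 2) :=
        Finset.sum_le_sum fun i _ => Finset.sum_le_sum fun j _ => h1 i j
    _ = K * Fintype.card n * (x ⬝ᵥ x) := by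
        simp only [← Finset.mul_sum, ← Finset.sum_div, Finset.sum_add_distrib, Finset.sum_const,
          Finset.card_univ, nsmul_eq_mul, dotProduct]
        have h (i : n) : x i * (Fintype.card n * x i) = Fintype.card n * (x i * x i) := by ring
        simp only [h, ← Finset.mul_sum]
        ring

open scoped Matrix.Norms.Elementwise in
lemma exists_dotProduct_mulVec_le_on_Icc {P : ℝ → Matrix n n ℝ} {a b : ℝ}
    (hP : ContinuousOn P (Icc a b)) :
    ∃ K, 0 ≤ K ∧ ∀ t ∈ Icc a b, ∀ x, x ⬝ᵥ (P t *ᵥ x) ≤ K * (x ⬝ᵥ x) := by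
  obtain ⟨K, hK0, hK⟩ := exists_norm_le_of_continuousOn_Icc hP
  exact ⟨K * Fintype.card n, by positivity, fun t ht =>
    dotProduct_mulVec_le_of_abs_entry_le fun i j =>
      (norm_entry_le_entrywise_sup_norm (P t)).trans (hK t ht)⟩

/-- An upper bound `K` for the form of `M⁻¹` yields the lower bound: with `r = (K + 1)⁻¹`,
nonnegativity of `M` at `x - r M⁻¹ x` gives `x ⬝ M x ≥ 2r |x|² - r² x ⬝ M⁻¹ x ≥ r |x|²`. -/
lemma exists_pos_le_dotProduct_mulVec [DecidableEq n] {M : Matrix n n ℝ} (hM : M.PosDef) :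
    ∃ c, 0 < c ∧ ∀ x, c * (x ⬝ᵥ x) ≤ x ⬝ᵥ (M *ᵥ x) := by
  obtain ⟨K, hK0, hK⟩ := exists_dotProduct_mulVec_le_on_Icc (P := fun _ => M⁻¹) (a := 0) (b := 0)
    continuousOn_const
  have hunit : M * M⁻¹ = 1 := Matrix.mul_nonsing_inv _ ((Matrix.isUnit_iff_isUnit_det _).1 hM.isUnit)
  have hsymm : Mᵀ = M := hM.posSemidef.1
  have hpos := (posSemidef_iff_transpose_eq_and_dotProduct_nonneg.1 hM.posSemidef).2
  refine ⟨(K + 1)⁻¹, by positivity, fun x => ?_⟩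
  have hx := hK 0 (by simp) x
  have h1 := hpos (x - (K + 1)⁻¹ • (M⁻¹ *ᵥ x))
  have h2 : M *ᵥ (M⁻¹ *ᵥ x) = x := by rw [Matrix.mulVec_mulVec, hunit, Matrix.one_mulVec]
  have h3 : (M⁻¹ *ᵥ x) ⬝ᵥ (M *ᵥ x) = x ⬝ᵥ x := by
    have := dotProduct_transpose_mulVec_eq M (M⁻¹ *ᵥ x) x
    rwa [hsymm, h2] at this
  simp only [Matrix.mulVec_sub, Matrix.mulVec_smul, h2, sub_dotProduct, dotProduct_sub,
    smul_dotProduct, dotProduct_smul, smul_eq_mul, h3, dotProduct_comm (M⁻¹ *ᵥ x) x] at h1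
  set r := (K + 1)⁻¹ with hr
  have hr0 : 0 < r := by positivity
  have h4 : r * (r * (x ⬝ᵥ (M⁻¹ *ᵥ x))) ≤ r * (x ⬝ᵥ x) := by
    refine mul_le_mul_of_nonneg_left ?_ hr0.le
    calc r * (x ⬝ᵥ (M⁻¹ *ᵥ x)) ≤ r * (K * (x ⬝ᵥ x)) := mul_le_mul_of_nonneg_left hx hr0.le
      _ ≤ r * ((K + 1) * (x ⬝ᵥ x)) := by
          refine mul_le_mul_of_nonneg_left ?_ hr0.le
          nlinarith [real_dotProduct_self_nonneg x]
      _ = x ⬝ᵥ x := by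
          rw [hr]
          field_simp
  linarith

variable {A : ℝ → Matrix n n ℝ} {C : ℝ → Matrix m n ℝ} {D : ℝ → Matrix m m ℝ}
  {S : ℝ → Matrix n n ℝ} {P : ℝ → Matrix n n ℝ}

/-- The derivative of `z ⬝ P z` along a Riccati solution. -/
lemma IsRiccatiSolution.hasDerivWithinAt_dotProduct (hP : IsRiccatiSolution A C D S P)
    (hPs : ∀ t, 0 ≤ t → (P t)ᵀ = P t) {z : ℝ → n → ℝ} {z' : n → ℝ} {a b t : ℝ} (ha : 0 ≤ a)
    (ht : t ∈ Icc a b) (hz : HasDerivWithinAt z z' (Icc a b) t) :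
    HasDerivWithinAt (fun τ => z τ ⬝ᵥ (P τ *ᵥ z τ))
      (2 * ((P t *ᵥ z t) ⬝ᵥ (z' + (A t)ᵀ *ᵥ z t)) + z t ⬝ᵥ (S t *ᵥ z t) -
        (C t *ᵥ (P t *ᵥ z t)) ⬝ᵥ (D t *ᵥ (C t *ᵥ (P t *ᵥ z t)))) (Icc a b) t := by
  have hsub : Icc a b ⊆ Ici 0 := fun s hs => ha.trans hs.1
  have h0 : 0 ≤ t := hsub ht
  refine (hz.dotProduct (((hP t h0).mono hsub).mulVec hz)).congr_deriv ?_
  have hs : ∀ x y : n → ℝ, x ⬝ᵥ (P t *ᵥ y) = (P t *ᵥ x) ⬝ᵥ y := fun x y => by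
    conv_lhs => rw [← hPs t h0]
    exact dotProduct_transpose_mulVec_eq _ _ _
  have e1 : z t ⬝ᵥ (A t *ᵥ (P t *ᵥ z t)) = (P t *ᵥ z t) ⬝ᵥ ((A t)ᵀ *ᵥ z t) := by
    rw [dotProduct_transpose_mulVec_eq, dotProduct_comm]
  have e2 : z t ⬝ᵥ ((P t * (C t)ᵀ * D t * C t * P t) *ᵥ z t) =
      (C t *ᵥ (P t *ᵥ z t)) ⬝ᵥ (D t *ᵥ (C t *ᵥ (P t *ᵥ z t))) := by
    simp only [← Matrix.mulVec_mulVec]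
    rw [hs, dotProduct_transpose_mulVec_eq]
  rw [Matrix.add_mulVec, Matrix.sub_mulVec, Matrix.add_mulVec, dotProduct_add, dotProduct_add,
    dotProduct_sub, dotProduct_add, e2, ← Matrix.mulVec_mulVec, ← Matrix.mulVec_mulVec, e1,
    hs (z t) ((A t)ᵀ *ᵥ z t), hs (z t) z', dotProduct_add, dotProduct_comm z']
  ring

/-- With `G = Cᵀ D C`, the difference `P - ε` satisfies a Lyapunov equation with drift `A - (P + ε)
G / 2` and source `S + ε (A + Aᵀ) - ε² G`, which is nonnegative for small `ε`. Its sign therefore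
propagates from time `0`; the proof tests it along the adjoint flow of that drift. -/
theorem IsRiccatiSolution.exists_lower_bound (hA : ContinuousOn A (Ici 0))
    (hC : ContinuousOn C (Ici 0)) (hD : ContinuousOn D (Ici 0))
    (hDs : ∀ t, 0 ≤ t → (D t)ᵀ = D t) {M N a d : ℝ} (hM : 0 ≤ M) (hN : 0 ≤ N) (ha : 0 < a)
    (hd : 0 ≤ d) (hAM : ∀ t, 0 ≤ t → ∀ x, |x ⬝ᵥ (A t *ᵥ x)| ≤ M * (x ⬝ᵥ x))
    (hCN : ∀ t, 0 ≤ t → ∀ x, (C t *ᵥ x) ⬝ᵥ (C t *ᵥ x) ≤ N * (x ⬝ᵥ x))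
    (hDd : ∀ t, 0 ≤ t → ∀ x, x ⬝ᵥ (D t *ᵥ x) ≤ d * (x ⬝ᵥ x))
    (hSa : ∀ t, 0 ≤ t → ∀ x, a * (x ⬝ᵥ x) ≤ x ⬝ᵥ (S t *ᵥ x))
    (hP : IsRiccatiSolution A C D S P) (hPs : ∀ t, 0 ≤ t → (P t)ᵀ = P t)
    {ε₀ : ℝ} (hε₀ : 0 < ε₀) (hP0 : ∀ x, ε₀ * (x ⬝ᵥ x) ≤ x ⬝ᵥ (P 0 *ᵥ x)) :
    ∃ ε, 0 < ε ∧ ∀ t, 0 ≤ t → ∀ x, ε * (x ⬝ᵥ x) ≤ x ⬝ᵥ (P t *ᵥ x) := by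
  set κ : ℝ := 2 * M + d * N + 1 with hκ
  have hκ0 : 0 < κ := by positivity
  -- `ε₀` handles time `0`, `1` allows `ε²` to be replaced by `ε`, and `a / κ` lets `S` absorb the
  -- remaining terms.
  set ε : ℝ := min ε₀ (min 1 (a / κ)) with hε
  have hεpos : 0 < ε := lt_min hε₀ (lt_min one_pos (div_pos ha hκ0))
  have hε1 : ε ≤ 1 := (min_le_right _ _).trans (min_le_left _ _)
  have hεa : ε * κ ≤ a := by
    rw [← le_div_iff₀ hκ0]
    exact (min_le_right _ _).trans (min_le_right _ _)
  refine ⟨ε, hεpos, fun T hT w => ?_⟩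
  have hG : ContinuousOn (fun t => (C t)ᵀ * D t * C t) (Ici 0) :=
    (hC.matrix_transpose.matrix_mul hD).matrix_mul hC
  -- This drift cancels every term containing `P` in the derivative of `z ⬝ P z - ε |z|²`, leaving
  -- `z ⬝ S z + 2ε z ⬝ A z - ε² z ⬝ G z`.
  have hF : ContinuousOn (fun t => -(A t)ᵀ + (ε / 2) • ((C t)ᵀ * D t * C t) +
      (1 / 2 : ℝ) • ((C t)ᵀ * D t * C t * P t)) (Icc 0 T) :=
    ((hA.matrix_transpose.neg.add (hG.const_smul (ε / 2))).add
      ((hG.matrix_mul hP.continuousOn).const_smul (1 / 2 : ℝ))).mono Icc_subset_Ici_self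
  obtain ⟨z, hzT, hz⟩ := exists_linearODE_solution_of_terminal hT hF w
  have hmono : z 0 ⬝ᵥ (P 0 *ᵥ z 0) - ε * (z 0 ⬝ᵥ z 0) ≤
      z T ⬝ᵥ (P T *ᵥ z T) - ε * (z T ⬝ᵥ z T) := by
    refine le_of_hasDerivWithinAt_nonneg
      (f := fun t => z t ⬝ᵥ (P t *ᵥ z t) - ε * (z t ⬝ᵥ z t)) hT
      (fun t ht => (hP.hasDerivWithinAt_dotProduct hPs le_rfl ht (hz t ht)).sub
        (((hz t ht).dotProduct (hz t ht)).const_mul ε)) ?_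
    intro t ht
    have ht0 : 0 ≤ t := ht.1
    have hGs : ∀ x y : n → ℝ, x ⬝ᵥ (((C t)ᵀ * D t * C t) *ᵥ y) =
        (C t *ᵥ x) ⬝ᵥ (D t *ᵥ (C t *ᵥ y)) := fun x y => by
      rw [← Matrix.mulVec_mulVec, ← Matrix.mulVec_mulVec, dotProduct_transpose_mulVec_eq]
    have hDc : (C t *ᵥ z t) ⬝ᵥ (D t *ᵥ (C t *ᵥ (P t *ᵥ z t))) =
        (C t *ᵥ (P t *ᵥ z t)) ⬝ᵥ (D t *ᵥ (C t *ᵥ z t)) := by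
      conv_lhs => rw [← hDs t ht0]
      rw [dotProduct_transpose_mulVec_eq, dotProduct_comm]
    have e1 : z t ⬝ᵥ ((A t)ᵀ *ᵥ z t) = z t ⬝ᵥ (A t *ᵥ z t) := by
      rw [dotProduct_transpose_mulVec_eq, dotProduct_comm]
    have e2 := abs_le.1 (hAM t ht0 (z t))
    have e3 := (hDd t ht0 (C t *ᵥ z t)).trans (mul_le_mul_of_nonneg_left (hCN t ht0 (z t)) hd)
    have e4 := hSa t ht0 (z t)
    have e5 := real_dotProduct_self_nonneg (z t)
    set z' := (-(A t)ᵀ + (ε / 2) • ((C t)ᵀ * D t * C t) +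
      (1 / 2 : ℝ) • ((C t)ᵀ * D t * C t * P t)) *ᵥ z t with hz'
    have hzz : ∀ x : n → ℝ, x ⬝ᵥ z' = -(x ⬝ᵥ ((A t)ᵀ *ᵥ z t)) +
        ε / 2 * ((C t *ᵥ x) ⬝ᵥ (D t *ᵥ (C t *ᵥ z t))) +
        1 / 2 * ((C t *ᵥ x) ⬝ᵥ (D t *ᵥ (C t *ᵥ (P t *ᵥ z t)))) := by
      intro x
      rw [hz', Matrix.add_mulVec, Matrix.add_mulVec, Matrix.neg_mulVec, Matrix.smul_mulVec,
        Matrix.smul_mulVec, ← Matrix.mulVec_mulVec _ _ (P t), dotProduct_add, dotProduct_add,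
        dotProduct_neg, dotProduct_smul, dotProduct_smul, hGs, hGs, smul_eq_mul, smul_eq_mul]
    rw [dotProduct_comm z' (z t), dotProduct_add, hzz, hzz, hDc, e1]
    have e6 : ε * (ε * ((C t *ᵥ z t) ⬝ᵥ (D t *ᵥ (C t *ᵥ z t)))) ≤
        ε * (1 * (d * (N * (z t ⬝ᵥ z t)))) := by
      refine mul_le_mul_of_nonneg_left ?_ hεpos.le
      refine (mul_le_mul_of_nonneg_left e3 hεpos.le).trans ?_
      exact mul_le_mul_of_nonneg_right hε1 (by positivity)
    have e7 : ε * (-(M * (z t ⬝ᵥ z t))) ≤ ε * (z t ⬝ᵥ (A t *ᵥ z t)) :=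
      mul_le_mul_of_nonneg_left e2.1 hεpos.le
    have e8 : ε * κ * (z t ⬝ᵥ z t) ≤ a * (z t ⬝ᵥ z t) := mul_le_mul_of_nonneg_right hεa e5
    have e9 : 0 ≤ ε * (z t ⬝ᵥ z t) := by positivity
    rw [hκ] at e8
    linarith
  have h0 := hP0 (z 0)
  have h0' : ε * (z 0 ⬝ᵥ z 0) ≤ ε₀ * (z 0 ⬝ᵥ z 0) :=
    mul_le_mul_of_nonneg_right (min_le_left _ _) (real_dotProduct_self_nonneg _)
  rw [hzT] at hmono
  linarith

end Bounds

/-! ### Observability and the upper bound on the Riccati solution -/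

section UpperBound

variable {m n : Type*} [Fintype m] [Fintype n] [DecidableEq n]
  {A : ℝ → Matrix n n ℝ} {C : ℝ → Matrix m n ℝ} {D : ℝ → Matrix m m ℝ}
  {S : ℝ → Matrix n n ℝ} {P : ℝ → Matrix n n ℝ}

lemma IsTransitionMatrix.eq_of_hasDerivWithinAt {Φ : ℝ → ℝ → Matrix n n ℝ}
    (hΦ : IsTransitionMatrix A Φ) (hA : ContinuousOn A (Ici 0)) {t₀ : ℝ} (ht₀ : 0 ≤ t₀)
    {X : ℝ → Matrix n n ℝ} (hX0 : X t₀ = 1)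
    (hX : ∀ t, t₀ ≤ t → MatHasDerivWithinAt X (A t * X t) (Ici t₀) t) {t : ℝ} (ht : t₀ ≤ t) :
    X t = Φ t t₀ := by
  have hsub : Icc t₀ t ⊆ Ici 0 := fun s hs => ht₀.trans hs.1
  have hcol : ∀ {Y : ℝ → Matrix n n ℝ} {s : ℝ} (_ : MatHasDerivWithinAt Y (A s * Y s) (Icc t₀ t) s)
      (j : n), HasDerivWithinAt (fun τ i => Y τ i j) (A s *ᵥ fun i => Y s i j) (Icc t₀ t) s :=
    fun h j => hasDerivWithinAt_pi.2 fun i => h i j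
  ext i j
  have h := eqOn_of_linearODE (hA.mono hsub)
    (fun s hs => hcol ((hX s hs.1).mono Icc_subset_Ici_self) j)
    (fun s hs => hcol (((hΦ t₀ ht₀).2 s (hsub hs)).mono hsub) j)
    (by simp only [hX0, (hΦ t₀ ht₀).1]) (right_mem_Icc.2 ht)
  exact congrFun h i

/-- Under uniform observability, the adjoint system `ż = -Aᵀ z - Cᵀ u` can be steered from the
origin to any state in time `δ`, with bounds on the control and the trajectory that are uniform in
the initial time. -/
lemma exists_adjoint_control {Φ : ℝ → ℝ → Matrix n n ℝ} (hΦ : IsTransitionMatrix A Φ)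
    (hA : ContinuousOn A (Ici 0)) (hC : ContinuousOn C (Ici 0)) {M N δ μ : ℝ} (hM : 0 ≤ M)
    (hN : 0 ≤ N) (hδ : 0 < δ) (hμ : 0 < μ)
    (hobs : ∀ t, 0 ≤ t → LoewnerGE (gramian Φ C t δ) μ)
    (hAM : ∀ t, 0 ≤ t → ∀ x, |x ⬝ᵥ (A t *ᵥ x)| ≤ M * (x ⬝ᵥ x))
    (hCN : ∀ t, 0 ≤ t → ∀ x, (C t *ᵥ x) ⬝ᵥ (C t *ᵥ x) ≤ N * (x ⬝ᵥ x)) :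
    ∃ K, 0 ≤ K ∧ ∀ t₀, 0 ≤ t₀ → ∀ w : n → ℝ, ∃ (z : ℝ → n → ℝ) (u : ℝ → m → ℝ),
      z t₀ = 0 ∧ z (t₀ + δ) = w ∧ ∀ t ∈ Icc t₀ (t₀ + δ),
        HasDerivWithinAt z (-((A t)ᵀ *ᵥ z t) - (C t)ᵀ *ᵥ u t) (Icc t₀ (t₀ + δ)) t ∧
        u t ⬝ᵥ u t ≤ K * (w ⬝ᵥ w) ∧ z t ⬝ᵥ z t ≤ K * (w ⬝ᵥ w) := by
  set ρ : ℝ := Real.exp (2 * M * δ) with hρ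
  have hρ1 : 1 ≤ ρ := Real.one_le_exp (by positivity)
  set κ : ℝ := ρ / (δ * μ) ^ 2 with hκ
  have hκ0 : 0 ≤ κ := by positivity
  set k : ℝ := 2 * M + N + 1 with hk
  have hk1 : 1 ≤ k := by rw [hk]; linarith
  set U : ℝ := N * (ρ * κ) with hU
  have hU0 : 0 ≤ U := by positivity
  refine ⟨U * Real.exp (k * δ), by positivity, fun t₀ ht₀ w => ?_⟩
  have hsub : Ici t₀ ⊆ Ici 0 := Ici_subset_Ici.2 ht₀
  have hA' := hA.mono hsub
  have hC' := hC.mono hsub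
  -- Minimum-energy control: `X` is the transition matrix, and `Z` is the adjoint response to the
  -- inputs `u = -C X`. Then `(Xᵀ Z)' = Xᵀ Cᵀ C X`, so `Xᵀ Z` ends at `δ` times the Gramian. This
  -- makes the final `Z` invertible, and `η` is chosen with `Z η = w`.
  obtain ⟨Z, X, hZ0, hX0, hZd, hXd⟩ := exists_blockLinear_solution
    (F₁₁ := fun t => -(A t)ᵀ) hA'.matrix_transpose.neg (hC'.matrix_transpose.matrix_mul hC') (F₂₁ := fun _ => (0 : Matrix n n ℝ))
    continuousOn_const hA' 0 1
  simp only [Matrix.zero_mul, zero_add] at hXd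
  have hXΦ : ∀ t, t₀ ≤ t → X t = Φ t t₀ := fun t ht =>
    hΦ.eq_of_hasDerivWithinAt hA ht₀ hX0 hXd ht
  have hle : t₀ ≤ t₀ + δ := by linarith
  have hXc : ContinuousOn X (Ici t₀) := MatHasDerivWithinAt.continuousOn hXd
  have hgram : δ • gramian Φ C t₀ δ = (X (t₀ + δ))ᵀ * Z (t₀ + δ) := by
    have hd : ∀ t, t₀ ≤ t → MatHasDerivWithinAt (fun t => (X t)ᵀ * Z t)
        ((X t)ᵀ * (C t)ᵀ * C t * X t) (Ici t₀) t := by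
      intro t ht
      have h := (hXd t ht).transpose.mul (hZd t ht)
      convert h using 1
      simp only [Matrix.transpose_mul, Matrix.mul_add, Matrix.neg_mul, Matrix.mul_neg,
        Matrix.mul_assoc]
      abel
    have hcont : ContinuousOn (fun t => (X t)ᵀ * (C t)ᵀ * C t * X t) (Ici t₀) :=
      ((hXc.matrix_transpose.matrix_mul hC'.matrix_transpose).matrix_mul hC').matrix_mul hXc
    rw [gramian, smul_smul, mul_one_div_cancel hδ.ne', one_smul]
    ext i j
    have hint := intervalIntegral.integral_eq_sub_of_hasDeriv_right_of_le hle
      (f := fun t => ((X t)ᵀ * Z t) i j)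
      (f' := fun t => ((X t)ᵀ * (C t)ᵀ * C t * X t) i j)
      (fun t ht => (hd t ht.1 i j).continuousWithinAt.mono Icc_subset_Ici_self)
      (fun t ht => (hd t ht.1.le i j).mono (fun s hs => ht.1.le.trans (le_of_lt hs)))
      (ContinuousOn.intervalIntegrable (by
        rw [uIcc_of_le hle]
        exact (continuousOn_pi.1 (continuousOn_pi.1 hcont i) j).mono Icc_subset_Ici_self))
    rw [hZ0, Matrix.mul_zero, Matrix.zero_apply, sub_zero] at hint
    rw [← hint, matIntegral, Matrix.of_apply]
    refine intervalIntegral.integral_congr fun s hs => ?_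
    rw [uIcc_of_le hle] at hs
    simp only [hXΦ s hs.1]
  have hpair : ∀ η, δ * μ * (η ⬝ᵥ η) ≤ (X (t₀ + δ) *ᵥ η) ⬝ᵥ (Z (t₀ + δ) *ᵥ η) := by
    intro η
    have h := (loewnerGE_iff.1 (hobs t₀ ht₀)).2 η
    have h2 : δ * (η ⬝ᵥ (gramian Φ C t₀ δ *ᵥ η)) =
        (X (t₀ + δ) *ᵥ η) ⬝ᵥ (Z (t₀ + δ) *ᵥ η) := by
      rw [← smul_eq_mul, ← dotProduct_smul, ← Matrix.smul_mulVec, hgram, ← Matrix.mulVec_mulVec,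
        dotProduct_transpose_mulVec_eq]
    rw [← h2, mul_assoc]
    exact mul_le_mul_of_nonneg_left h hδ.le
  have hunit : IsUnit (Z (t₀ + δ)) := by
    rw [← Matrix.mulVec_injective_iff_isUnit]
    refine (injective_iff_map_eq_zero (Z (t₀ + δ)).mulVecLin).2 fun v hv => ?_
    have h := hpair v
    rw [show Z (t₀ + δ) *ᵥ v = 0 from hv, dotProduct_zero] at h
    have h0 : v ⬝ᵥ v = 0 := le_antisymm
      (nonpos_of_mul_nonpos_right h (by positivity)) (real_dotProduct_self_nonneg v)
    exact dotProduct_self_eq_zero.1 h0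
  obtain ⟨η, hη⟩ := (Matrix.mulVec_surjective_iff_isUnit.2 hunit) w
  have hXη : ∀ t ∈ Icc t₀ (t₀ + δ), (X t *ᵥ η) ⬝ᵥ (X t *ᵥ η) ≤ ρ * (η ⬝ᵥ η) := by
    intro t ht
    have hx : ∀ s ∈ Icc t₀ t, HasDerivWithinAt (fun s => X s *ᵥ η) (A s *ᵥ (X s *ᵥ η))
        (Icc t₀ t) s := fun s hs => by
      have := ((hXd s hs.1).mono Icc_subset_Ici_self).mulVec
        (hasDerivWithinAt_const s (Icc t₀ t) η)
      simpa using this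
    have h := le_mul_exp_of_hasDerivWithinAt_le (k := 2 * M) ht.1
      (fun s hs => (hx s hs).dotProduct (hx s hs)) (fun s hs => by
        have h1 := (abs_le.1 (hAM s (ht₀.trans hs.1) (X s *ᵥ η))).2
        rw [dotProduct_comm (A s *ᵥ (X s *ᵥ η))]
        linarith)
    rw [hX0, Matrix.one_mulVec, mul_comm] at h
    refine h.trans (mul_le_mul_of_nonneg_right (Real.exp_le_exp.2 ?_) (real_dotProduct_self_nonneg η))
    exact mul_le_mul_of_nonneg_left (by linarith [ht.2]) (by positivity)
  -- From `δμ |η|² ≤ Xη ⬝ w` and `|Xη|² ≤ ρ |η|²`; the weight `δμ / ρ` in Young's inequality lets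
  -- half of the left side absorb the `Xη` term.
  have hηw : η ⬝ᵥ η ≤ κ * (w ⬝ᵥ w) := by
    have h1 := hpair η
    rw [hη] at h1
    have h2 := two_mul_dotProduct_le (c := δ * μ / ρ) (by positivity) (X (t₀ + δ) *ᵥ η) w
    have h3 := mul_le_mul_of_nonneg_left (hXη (t₀ + δ) (right_mem_Icc.2 hle))
      (show 0 ≤ δ * μ / ρ by positivity)
    have h4 : δ * μ / ρ * (ρ * (η ⬝ᵥ η)) = δ * μ * (η ⬝ᵥ η) := by field_simp
    have h5 : δ * μ * (η ⬝ᵥ η) ≤ (δ * μ / ρ)⁻¹ * (w ⬝ᵥ w) := by linarith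
    have h6 : κ * (w ⬝ᵥ w) = (δ * μ)⁻¹ * ((δ * μ / ρ)⁻¹ * (w ⬝ᵥ w)) := by
      rw [hκ]
      field_simp
    rw [h6, ← div_eq_inv_mul, le_div_iff₀ (by positivity), mul_comm]
    exact h5
  have hu : ∀ t ∈ Icc t₀ (t₀ + δ), (-(C t *ᵥ (X t *ᵥ η))) ⬝ᵥ (-(C t *ᵥ (X t *ᵥ η))) ≤
      U * (w ⬝ᵥ w) := by
    intro t ht
    rw [neg_dotProduct_neg]
    refine (hCN t (ht₀.trans ht.1) _).trans ?_
    rw [hU, mul_assoc N, mul_assoc ρ]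
    exact mul_le_mul_of_nonneg_left ((hXη t ht).trans
      (mul_le_mul_of_nonneg_left hηw (by positivity))) hN
  have hw := real_dotProduct_self_nonneg w
  have hz : ∀ t ∈ Icc t₀ (t₀ + δ), HasDerivWithinAt (fun t => Z t *ᵥ η)
      (-((A t)ᵀ *ᵥ (Z t *ᵥ η)) - (C t)ᵀ *ᵥ (-(C t *ᵥ (X t *ᵥ η)))) (Icc t₀ (t₀ + δ)) t := by
    intro t ht
    have := ((hZd t ht.1).mono Icc_subset_Ici_self).mulVec
      (hasDerivWithinAt_const t (Icc t₀ (t₀ + δ)) η)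
    refine this.congr_deriv ?_
    simp [Matrix.add_mulVec, Matrix.neg_mulVec, Matrix.mulVec_neg, Matrix.mulVec_mulVec,
      Matrix.mul_assoc]
  refine ⟨fun t => Z t *ᵥ η, fun t => -(C t *ᵥ (X t *ᵥ η)), by simp [hZ0], hη,
    fun t ht => ⟨hz t ht, ?_, ?_⟩⟩
  · refine (hu t ht).trans ?_
    rw [mul_right_comm U]
    exact le_mul_of_one_le_right (by positivity) (Real.one_le_exp (by positivity))
  -- Since `-2 Cz ⬝ u ≤ |Cz|² + |u|²`, the energy obeys `(|z|²)' ≤ (2M + N) |z|² + U |w|²`. The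
  -- extra `1` in `k` meets the condition `1 ≤ k` of the Grönwall lemma.
  · have hsub' : Icc t₀ t ⊆ Icc t₀ (t₀ + δ) := Icc_subset_Icc_right ht.2
    have h := le_mul_exp_of_hasDerivWithinAt_le_add (k := k) (c := U * (w ⬝ᵥ w)) ht.1 hk1
      (by positivity)
      (fun s hs => ((hz s (hsub' hs)).mono hsub').dotProduct ((hz s (hsub' hs)).mono hsub'))
      (fun s hs => by
        have hs0 : 0 ≤ s := ht₀.trans hs.1
        have h1 := (abs_le.1 (hAM s hs0 (Z s *ᵥ η))).1
        have h2 := hCN s hs0 (Z s *ᵥ η)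
        have h3 := hu s (hsub' hs)
        set u := -(C s *ᵥ (X s *ᵥ η))
        set z := Z s *ᵥ η
        have h4 := real_dotProduct_self_nonneg (C s *ᵥ z + u)
        have h5 := real_dotProduct_self_nonneg z
        have e1 : z ⬝ᵥ ((A s)ᵀ *ᵥ z) = z ⬝ᵥ (A s *ᵥ z) := by
          rw [dotProduct_transpose_mulVec_eq, dotProduct_comm]
        rw [dotProduct_comm _ z, dotProduct_sub, dotProduct_neg, e1,
          dotProduct_transpose_mulVec_eq]
        simp only [add_dotProduct, dotProduct_add, dotProduct_comm u] at h4
        rw [hk]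
        linarith)
    simp only [hZ0, Matrix.zero_mulVec, dotProduct_zero, zero_add] at h
    rw [mul_right_comm U]
    refine h.trans (mul_le_mul_of_nonneg_left (Real.exp_le_exp.2 ?_) (by positivity))
    exact mul_le_mul_of_nonneg_left (by linarith [ht.2]) (by linarith)

theorem IsRiccatiSolution.exists_upper_bound (hA : ContinuousOn A (Ici 0))
    (hC : ContinuousOn C (Ici 0)) (hobs : UniformlyObservable A C)
    {M N b d : ℝ} (hM : 0 ≤ M) (hN : 0 ≤ N) (hb : 0 ≤ b) (hd : 0 < d)
    (hAM : ∀ t, 0 ≤ t → ∀ x, |x ⬝ᵥ (A t *ᵥ x)| ≤ M * (x ⬝ᵥ x))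
    (hCN : ∀ t, 0 ≤ t → ∀ x, (C t *ᵥ x) ⬝ᵥ (C t *ᵥ x) ≤ N * (x ⬝ᵥ x))
    (hDd : ∀ t, 0 ≤ t → ∀ x, d * (x ⬝ᵥ x) ≤ x ⬝ᵥ (D t *ᵥ x))
    (hSb : ∀ t, 0 ≤ t → ∀ x, x ⬝ᵥ (S t *ᵥ x) ≤ b * (x ⬝ᵥ x))
    (hP : IsRiccatiSolution A C D S P) (hPs : ∀ t, 0 ≤ t → (P t)ᵀ = P t) :
    ∃ β, 0 < β ∧ ∀ t, 0 ≤ t → ∀ x, x ⬝ᵥ (P t *ᵥ x) ≤ β * (x ⬝ᵥ x) := by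
  obtain ⟨Φ, hΦ, δ, μ, hδ, hμ, hg⟩ := hobs
  obtain ⟨K, hK0, hK⟩ := exists_adjoint_control hΦ hA hC hM hN hδ hμ hg hAM hCN
  obtain ⟨L, hL0, hL⟩ := exists_dotProduct_mulVec_le_on_Icc
    (hP.continuousOn.mono (Icc_subset_Ici_self : Icc 0 δ ⊆ Ici 0))
  set β : ℝ := (b * K + d⁻¹ * K) * δ with hβ
  have hβ0 : 0 ≤ β := by positivity
  refine ⟨L + β + 1, by positivity, fun t ht w => ?_⟩
  have hw := real_dotProduct_self_nonneg w
  rcases le_total t δ with h | h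
  -- Before time `δ` there is no full window to steer over; compactness supplies the bound `L`
  -- instead.
  · nlinarith [hL t ⟨ht, h⟩ w, mul_nonneg hβ0 hw]
  · have ht₀ : 0 ≤ t - δ := sub_nonneg.2 h
    obtain ⟨z, u, hz0, hzw, hz⟩ := hK (t - δ) ht₀ w
    set c : ℝ := (b * K + d⁻¹ * K) * (w ⬝ᵥ w) with hc
    -- The cost rate of the steering is at most `c`: `-2 q ⬝ u - q ⬝ D q ≤ d⁻¹ |u|²` with `q = C P
    -- z`. As `z` starts at `0`, integrating gives `w ⬝ P w ≤ δ c`.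
    have hmono := le_of_hasDerivWithinAt_nonneg
      (f := fun s => s * c - z s ⬝ᵥ (P s *ᵥ z s)) (a := t - δ) (b := t - δ + δ) (by linarith)
      (fun s hs => ((hasDerivWithinAt_id s _).mul_const c).sub
        (hP.hasDerivWithinAt_dotProduct hPs ht₀ hs (hz s hs).1)) (fun s hs => by
        obtain ⟨-, h1, h2⟩ := hz s hs
        have hs0 : 0 ≤ s := ht₀.trans hs.1
        have e1 := (hSb s hs0 (z s)).trans (mul_le_mul_of_nonneg_left h2 hb)
        set q := C s *ᵥ (P s *ᵥ z s)
        have e2 := hDd s hs0 q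
        have e3 := two_mul_dotProduct_le hd q (-u s)
        rw [neg_dotProduct_neg, dotProduct_neg] at e3
        have e4 := mul_le_mul_of_nonneg_left h1 (inv_nonneg.2 hd.le)
        have e5 : (P s *ᵥ z s) ⬝ᵥ (-((A s)ᵀ *ᵥ z s) - (C s)ᵀ *ᵥ u s + (A s)ᵀ *ᵥ z s) =
            -(q ⬝ᵥ u s) := by
          rw [neg_sub_left, neg_add, neg_add_cancel_right, dotProduct_neg,
            dotProduct_transpose_mulVec_eq]
        rw [e5, hc]
        linarith)
    simp only [hz0, zero_dotProduct, sub_zero, hzw] at hmono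
    rw [sub_add_cancel] at hmono
    have e6 : c * δ = β * (w ⬝ᵥ w) := by rw [hc, hβ]; ring
    nlinarith [mul_nonneg hL0 hw]

end UpperBound

/-! ### Exponential stability of the Riccati observer -/

section Stability

variable {m n : Type*} [Fintype m] [Fintype n]

lemma euclNorm_eq_sqrt (x : n → ℝ) : euclNorm x = √(x ⬝ᵥ x) := by
  rw [euclNorm, EuclideanSpace.norm_eq]
  simp [dotProduct, ← sq]

lemma euclNorm_sq (x : n → ℝ) : euclNorm x ^ 2 = x ⬝ᵥ x := by
  rw [euclNorm_eq_sqrt, Real.sq_sqrt (real_dotProduct_self_nonneg x)]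

variable [DecidableEq n]
  {A : ℝ → Matrix n n ℝ} {C : ℝ → Matrix m n ℝ} {D : ℝ → Matrix m m ℝ}
  {S : ℝ → Matrix n n ℝ} {P : ℝ → Matrix n n ℝ}

/-- For `V = x ⬝ P⁻¹ x` and `y = P⁻¹ x`, the closed loop gives `V' = -Cx ⬝ D Cx - y ⬝ S y ≤ -a
|y|²`, while `V = y ⬝ P y ≤ β |y|²`. Hence `V` decays at rate `a / β`, and the norm at half that
rate. -/
theorem IsRiccatiSolution.globallyExponentiallyStable_of_bounds (hA : ContinuousOn A (Ici 0))
    (hC : ContinuousOn C (Ici 0)) (hD : ContinuousOn D (Ici 0))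
    (hDpos : ∀ t, 0 ≤ t → ∀ x, 0 ≤ x ⬝ᵥ (D t *ᵥ x)) {a ε β : ℝ} (ha : 0 < a) (hε : 0 < ε)
    (hβ : 0 < β) (hSa : ∀ t, 0 ≤ t → ∀ x, a * (x ⬝ᵥ x) ≤ x ⬝ᵥ (S t *ᵥ x))
    (hP : IsRiccatiSolution A C D S P) (hPs : ∀ t, 0 ≤ t → (P t)ᵀ = P t)
    (hPε : ∀ t, 0 ≤ t → ∀ x, ε * (x ⬝ᵥ x) ≤ x ⬝ᵥ (P t *ᵥ x))
    (hPβ : ∀ t, 0 ≤ t → ∀ x, x ⬝ᵥ (P t *ᵥ x) ≤ β * (x ⬝ᵥ x)) :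
    GloballyExponentiallyStable (fun t => A t - riccatiGain C D P t * C t) := by
  have hunit : ∀ t, 0 ≤ t → IsUnit (P t) := by
    intro t ht
    rw [← Matrix.mulVec_injective_iff_isUnit]
    refine (injective_iff_map_eq_zero (P t).mulVecLin).2 fun v hv => ?_
    have h := hPε t ht v
    rw [show P t *ᵥ v = 0 from hv, dotProduct_zero] at h
    exact dotProduct_self_eq_zero.1
      (le_antisymm (nonpos_of_mul_nonpos_right h hε) (real_dotProduct_self_nonneg v))
  have hPP : ∀ t, 0 ≤ t → P t * (P t)⁻¹ = 1 := fun t ht =>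
    Matrix.mul_nonsing_inv _ ((Matrix.isUnit_iff_isUnit_det _).1 (hunit t ht))
  have hF : ContinuousOn (fun t => A t - riccatiGain C D P t * C t) (Ici 0) :=
    hA.sub (((hP.continuousOn.matrix_mul hC.matrix_transpose).matrix_mul hD).matrix_mul hC)
  -- Inverting `ε ⪯ P ⪯ β`: the first half uses nonnegativity of `P` at `x - β P⁻¹ x`, the second
  -- Young's inequality with weight `ε`.
  have hV : ∀ t, 0 ≤ t → ∀ x, x ⬝ᵥ x ≤ β * (x ⬝ᵥ ((P t)⁻¹ *ᵥ x)) ∧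
      ε * (x ⬝ᵥ ((P t)⁻¹ *ᵥ x)) ≤ x ⬝ᵥ x := by
    intro t ht x
    set y := (P t)⁻¹ *ᵥ x with hy
    have hx : P t *ᵥ y = x := by rw [hy, Matrix.mulVec_mulVec, hPP t ht, Matrix.one_mulVec]
    have hyx : y ⬝ᵥ (P t *ᵥ x) = x ⬝ᵥ x := by
      have := dotProduct_transpose_mulVec_eq (P t) y x
      rwa [hPs t ht, hx] at this
    constructor
    · have h1 := hPε t ht (x - β • y)
      have h2 := hPβ t ht x
      have h3 := mul_nonneg hε.le (real_dotProduct_self_nonneg (x - β • y))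
      have h4 : (x - β • y) ⬝ᵥ (P t *ᵥ (x - β • y)) =
          x ⬝ᵥ (P t *ᵥ x) - 2 * β * (x ⬝ᵥ x) + β ^ 2 * (x ⬝ᵥ y) := by
        simp only [Matrix.mulVec_sub, Matrix.mulVec_smul, hx, sub_dotProduct, dotProduct_sub,
          smul_dotProduct, dotProduct_smul, smul_eq_mul, hyx, dotProduct_comm y x]
        ring
      have h5 : β * (x ⬝ᵥ x) ≤ β * (β * (x ⬝ᵥ y)) := by linarith
      exact le_of_mul_le_mul_left h5 hβ
    · have h1 := hPε t ht y
      rw [hx, dotProduct_comm y x] at h1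
      have h2 := two_mul_dotProduct_le hε y x
      rw [dotProduct_comm y x] at h2
      have h3 : x ⬝ᵥ y ≤ ε⁻¹ * (x ⬝ᵥ x) := by linarith
      rwa [← div_eq_inv_mul, le_div_iff₀ hε, mul_comm] at h3
  refine ⟨√(β / ε), a / β / 2, by positivity, by positivity, fun t₀ ht₀ x₀ => ⟨?_, ?_⟩⟩
  · exact exists_isLinearSolution (hF.mono (Ici_subset_Ici.2 ht₀)) x₀
  · intro x hx hx0 t ht
    have hsub : Icc t₀ t ⊆ Ici 0 := fun s hs => ht₀.trans hs.1
    have hdecay := le_mul_exp_of_hasDerivWithinAt_le (k := -(a / β)) ht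
      (fun s hs => ((hx s hs.1).mono Icc_subset_Ici_self).dotProduct
        ((((hP s (hsub hs)).mono hsub).inv (hunit s (hsub hs))).mulVec
          ((hx s hs.1).mono Icc_subset_Ici_self))) (fun s hs => by
        have hs0 : 0 ≤ s := hsub hs
        have hPPs := hPP s hs0
        have hPinv : ((P s)⁻¹)ᵀ = (P s)⁻¹ := by rw [Matrix.transpose_nonsing_inv, hPs s hs0]
        generalize hR : (P s)⁻¹ = R at *
        set y := R *ᵥ x s with hy
        have hxy : P s *ᵥ y = x s := by rw [hy, Matrix.mulVec_mulVec, hPPs, Matrix.one_mulVec]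
        have hRs : ∀ v : n → ℝ, x s ⬝ᵥ (R *ᵥ v) = y ⬝ᵥ v := fun v => by
          conv_lhs => rw [← hPinv]
          exact dotProduct_transpose_mulVec_eq _ _ _
        have hFx : (A s - riccatiGain C D P s * C s) *ᵥ x s =
            A s *ᵥ x s - P s *ᵥ ((C s)ᵀ *ᵥ (D s *ᵥ (C s *ᵥ x s))) := by
          simp only [riccatiGain, Matrix.sub_mulVec, Matrix.mulVec_mulVec, Matrix.mul_assoc]
        have hPy : ∀ v : n → ℝ, y ⬝ᵥ (P s *ᵥ v) = x s ⬝ᵥ v := fun v => by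
          conv_lhs => rw [← hPs s hs0]
          rw [dotProduct_transpose_mulVec_eq, hxy]
        have hAy : x s ⬝ᵥ ((A s)ᵀ *ᵥ y) = y ⬝ᵥ (A s *ᵥ x s) := by
          rw [dotProduct_transpose_mulVec_eq, dotProduct_comm]
        have e1 : y ⬝ᵥ ((A s * P s + P s * (A s)ᵀ - P s * (C s)ᵀ * D s * C s * P s + S s) *ᵥ y) =
            2 * (y ⬝ᵥ (A s *ᵥ x s)) - (C s *ᵥ x s) ⬝ᵥ (D s *ᵥ (C s *ᵥ x s)) +
              y ⬝ᵥ (S s *ᵥ y) := by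
          simp only [Matrix.add_mulVec, Matrix.sub_mulVec, dotProduct_add, dotProduct_sub,
            ← Matrix.mulVec_mulVec, hxy, hPy, hAy]
          rw [dotProduct_transpose_mulVec_eq]
          ring
        have e2 : y ⬝ᵥ ((A s - riccatiGain C D P s * C s) *ᵥ x s) =
            y ⬝ᵥ (A s *ᵥ x s) - (C s *ᵥ x s) ⬝ᵥ (D s *ᵥ (C s *ᵥ x s)) := by
          rw [hFx, dotProduct_sub, hPy, dotProduct_transpose_mulVec_eq]
        rw [dotProduct_add, Matrix.neg_mulVec, dotProduct_neg, ← Matrix.mulVec_mulVec,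
          ← Matrix.mulVec_mulVec, hRs, hRs, ← hy, e1, dotProduct_comm _ y, e2]
        have e3 := hDpos s hs0 (C s *ᵥ x s)
        have e4 := hSa s hs0 y
        have e5 := hPβ s hs0 y
        rw [hxy, dotProduct_comm y] at e5
        have e6 : a / β * (x s ⬝ᵥ y) ≤ a * (y ⬝ᵥ y) := by
          rw [div_mul_eq_mul_div, div_le_iff₀ hβ]
          nlinarith
        linarith)
    have hV1 := (hV t (ht₀.trans ht) (x t)).1
    have hV0 := (hV t₀ ht₀ (x t₀)).2
    rw [hx0] at hV0 hdecay
    have hbound : euclNorm (x t) ^ 2 ≤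
        (√(β / ε) * Real.exp (-(a / β / 2) * (t - t₀)) * euclNorm x₀) ^ 2 := by
      rw [mul_pow, mul_pow, Real.sq_sqrt (by positivity), euclNorm_sq, euclNorm_sq,
        ← Real.exp_nat_mul]
      have e : ((2 : ℕ) : ℝ) * (-(a / β / 2) * (t - t₀)) = -(a / β) * (t - t₀) := by
        push_cast
        ring
      rw [e]
      have h0 : x₀ ⬝ᵥ ((P t₀)⁻¹ *ᵥ x₀) ≤ (x₀ ⬝ᵥ x₀) / ε := by
        rw [le_div_iff₀ hε, mul_comm]
        exact hV0
      calc x t ⬝ᵥ x t ≤ β * (x t ⬝ᵥ ((P t)⁻¹ *ᵥ x t)) := hV1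
        _ ≤ β * ((x₀ ⬝ᵥ x₀) / ε * Real.exp (-(a / β) * (t - t₀))) :=
            mul_le_mul_of_nonneg_left (hdecay.trans
              (mul_le_mul_of_nonneg_right h0 (Real.exp_nonneg _))) hβ.le
        _ = β / ε * Real.exp (-(a / β) * (t - t₀)) * (x₀ ⬝ᵥ x₀) := by ring
    refine le_of_sq_le_sq hbound ?_
    have : 0 ≤ euclNorm x₀ := norm_nonneg _
    positivity

/-- Existence, uniqueness and exponential stability for the Riccati observer of a uniformly
observable linear system. -/
theorem UniformlyObservable.riccati_observer [DecidableEq m] (hobs : UniformlyObservable A C)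
    (hA : ContinuousOn A (Ici 0)) (hC : ContinuousOn C (Ici 0))
    {M N : ℝ} (hM : 0 ≤ M) (hN : 0 ≤ N)
    (hAM : ∀ t, 0 ≤ t → ∀ x, |x ⬝ᵥ (A t *ᵥ x)| ≤ M * (x ⬝ᵥ x))
    (hCN : ∀ t, 0 ≤ t → ∀ x, (C t *ᵥ x) ⬝ᵥ (C t *ᵥ x) ≤ N * (x ⬝ᵥ x))
    (hS : IsWeight S) (hD : IsWeight D) {P₀ : Matrix n n ℝ} (hP₀ : P₀.PosDef) :
    (∃ P, IsRiccatiSolution A C D S P ∧ P 0 = P₀) ∧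
    (∀ P P', IsRiccatiSolution A C D S P → P 0 = P₀ →
      IsRiccatiSolution A C D S P' → P' 0 = P₀ → EqOn P P' (Ici 0)) ∧
    (∀ P, IsRiccatiSolution A C D S P → P 0 = P₀ →
      GloballyExponentiallyStable (fun t => A t - riccatiGain C D P t * C t)) := by
  obtain ⟨a, b, ha, hb, hSab⟩ := hS.exists_bounds
  obtain ⟨d, e, hd, he, hDde⟩ := hD.exists_bounds
  obtain ⟨ε₀, hε₀, hP₀ε⟩ := exists_pos_le_dotProduct_mulVec hP₀
  have hDpos : ∀ t, 0 ≤ t → ∀ x, 0 ≤ x ⬝ᵥ (D t *ᵥ x) := fun t ht x =>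
    (mul_nonneg hd.le (real_dotProduct_self_nonneg x)).trans ((hDde t ht).2 x).1
  have hSpos : ∀ t, 0 ≤ t → ∀ x, 0 ≤ x ⬝ᵥ (S t *ᵥ x) := fun t ht x =>
    (mul_nonneg ha.le (real_dotProduct_self_nonneg x)).trans ((hSab t ht).2 x).1
  refine ⟨?_, ?_, ?_⟩
  · exact exists_isRiccatiSolution hA hC hD.1 hS.1 hDpos hSpos fun x hx => by
      simpa using hP₀.dotProduct_mulVec_pos hx
  · intro P P' hP h0 hP' h0'
    exact hP.eqOn hA hC hD.1 hP' (h0.trans h0'.symm)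
  · intro P hP h0
    have hPs := hP.transpose_eq hA hC hD.1 (fun t ht => (hDde t ht).1) (fun t ht => (hSab t ht).1)
      (by rw [h0]; exact hP₀.posSemidef.1)
    obtain ⟨ε, hε, hPε⟩ := hP.exists_lower_bound hA hC hD.1 (fun t ht => (hDde t ht).1) hM hN ha
      he.le hAM hCN (fun t ht x => ((hDde t ht).2 x).2) (fun t ht x => ((hSab t ht).2 x).1) hPs
      hε₀ (by rw [h0]; exact hP₀ε)
    obtain ⟨β, hβ, hPβ⟩ := hP.exists_upper_bound hA hC hobs hM hN hb.le hd hAM hCN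
      (fun t ht x => ((hDde t ht).2 x).1) (fun t ht x => ((hSab t ht).2 x).2) hPs
    exact hP.globallyExponentiallyStable_of_bounds hA hC hD.1 hDpos ha hε hβ
      (fun t ht x => ((hSab t ht).2 x).1) hPs hPε hPβ

end Stability

/-! ### Projections and persistence of excitation -/

section Excitation

lemma proj_mulVec (u v : Fin 3 → ℝ) : proj u *ᵥ v = v - (u ⬝ᵥ v) • u := by
  rw [proj, Matrix.sub_mulVec, Matrix.one_mulVec, Matrix.vecMulVec_mulVec]
  simp

lemma dotProduct_proj_mulVec (u v : Fin 3 → ℝ) :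
    v ⬝ᵥ (proj u *ᵥ v) = v ⬝ᵥ v - (u ⬝ᵥ v) ^ 2 := by
  rw [proj_mulVec, dotProduct_sub, dotProduct_smul, smul_eq_mul, dotProduct_comm v u, sq]

lemma proj_mulVec_dotProduct_self {u : Fin 3 → ℝ} (hu : u ⬝ᵥ u = 1) (v : Fin 3 → ℝ) :
    (proj u *ᵥ v) ⬝ᵥ (proj u *ᵥ v) = v ⬝ᵥ v - (u ⬝ᵥ v) ^ 2 := by
  simp only [proj_mulVec, sub_dotProduct, dotProduct_sub, smul_dotProduct, dotProduct_smul,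
    smul_eq_mul, hu, dotProduct_comm v u]
  ring

lemma dotProduct_matIntegral_mulVec {n : Type*} [Fintype n] {F : ℝ → Matrix n n ℝ} {a b : ℝ}
    (hab : a ≤ b) (hF : ContinuousOn F (Icc a b)) (x : n → ℝ) :
    x ⬝ᵥ (matIntegral F a b *ᵥ x) = ∫ s in a..b, x ⬝ᵥ (F s *ᵥ x) := by
  have hcont : ∀ i j, ContinuousOn (fun s => x i * (F s i j * x j)) (uIcc a b) := fun i j => by
    rw [uIcc_of_le hab]
    exact continuousOn_const.mul
      ((continuousOn_pi.1 (continuousOn_pi.1 hF i) j).mul continuousOn_const)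
  simp only [dotProduct, Matrix.mulVec, Finset.mul_sum]
  rw [intervalIntegral.integral_finsetSum fun i _ =>
    (continuousOn_finsetSum _ fun j _ => hcont i j).intervalIntegrable]
  refine Finset.sum_congr rfl fun i _ => ?_
  rw [intervalIntegral.integral_finsetSum fun j _ => (hcont i j).intervalIntegrable]
  refine Finset.sum_congr rfl fun j _ => ?_
  rw [intervalIntegral.integral_const_mul, intervalIntegral.integral_mul_const]
  rfl

lemma matIntegral_transpose_eq {n : Type*} {F : ℝ → Matrix n n ℝ} (hF : ∀ s, (F s)ᵀ = F s)
    (a b : ℝ) : (matIntegral F a b)ᵀ = matIntegral F a b := by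
  ext i j
  simp only [matIntegral, Matrix.transpose_apply, Matrix.of_apply]
  refine intervalIntegral.integral_congr fun s _ => ?_
  exact congrFun (congrFun (hF s) i) j

lemma ContinuousOn.dotProduct {X n : Type*} [TopologicalSpace X] [Fintype n] {x y : X → n → ℝ}
    {s : Set X} (hx : ContinuousOn x s) (hy : ContinuousOn y s) :
    ContinuousOn (fun t => x t ⬝ᵥ y t) s := by
  rw [continuousOn_iff_continuous_domRestrict] at *
  exact Continuous.dotProduct hx hy

lemma ContinuousOn.proj {X : Type*} [TopologicalSpace X] {y : X → Fin 3 → ℝ} {s : Set X}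
    (hy : ContinuousOn y s) : ContinuousOn (fun t => proj (y t)) s := by
  rw [continuousOn_iff_continuous_domRestrict] at *
  exact continuous_const.sub (Continuous.matrix_vecMulVec hy hy)

/-- A persistently exciting direction also observes affine motions, uniformly in time. -/
theorem PersistentlyExciting.exists_affine_bound {y : ℝ → Fin 3 → ℝ} (hy : PersistentlyExciting y)
    (hc : ContinuousOn y (Ici 0)) (hu : ∀ t, 0 ≤ t → y t ⬝ᵥ y t = 1) :
    ∃ δ μ : ℝ, 0 < δ ∧ 0 < μ ∧ ∀ t, 0 ≤ t → ∀ v w : Fin 3 → ℝ,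
      μ * (v ⬝ᵥ v + w ⬝ᵥ w) ≤ ∫ s in t..t + δ, (v + (s - t) • w) ⬝ᵥ (v + (s - t) • w) -
        (y s ⬝ᵥ (v + (s - t) • w)) ^ 2 := by
  obtain ⟨δ, μ, hδ, hμ, hpe⟩ := hy
  set q : ℝ → (Fin 3 → ℝ) → ℝ := fun s v => v ⬝ᵥ v - (y s ⬝ᵥ v) ^ 2 with hq
  have hq0 : ∀ s, 0 ≤ s → ∀ v, 0 ≤ q s v := fun s hs v => by
    simp only [hq]
    rw [← proj_mulVec_dotProduct_self (hu s hs)]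
    exact real_dotProduct_self_nonneg _
  have hqle : ∀ s v, q s v ≤ v ⬝ᵥ v := fun s v => by
    simp only [hq]
    linarith [sq_nonneg (y s ⬝ᵥ v)]
  -- The parallelogram identity for the nonnegative form `q`, applied to `v + r w` and `r w`.
  have hqadd : ∀ s, 0 ≤ s → ∀ (r : ℝ) (v w : Fin 3 → ℝ),
      1 / 2 * q s v - r ^ 2 * (w ⬝ᵥ w) ≤ q s (v + r • w) := fun s hs r v w => by
    have h1 := hq0 s hs (v + (2 * r) • w)
    have h2 := mul_le_mul_of_nonneg_left (hqle s w) (sq_nonneg r)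
    have h3 : q s (v + (2 * r) • w) = 2 * q s (v + r • w) - q s v + 2 * (r ^ 2 * q s w) := by
      simp only [hq, add_dotProduct, dotProduct_add, smul_dotProduct, dotProduct_smul, smul_eq_mul,
        dotProduct_comm w v]
      ring
    linarith
  have hpe' : ∀ t, 0 ≤ t → ∀ v, δ * μ * (v ⬝ᵥ v) ≤ ∫ s in t..t + δ, q s v := by
    intro t ht v
    have h := (loewnerGE_iff.1 (hpe t ht)).2 v
    rw [Matrix.smul_mulVec, dotProduct_smul, smul_eq_mul,
      dotProduct_matIntegral_mulVec (by linarith)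
        (hc.proj.mono fun s hs => ht.trans hs.1)] at h
    simp only [dotProduct_proj_mulVec] at h
    rw [one_div, ← div_eq_inv_mul, le_div_iff₀ hδ] at h
    linarith
  have hqc : ∀ (t : ℝ) (v w : Fin 3 → ℝ), ContinuousOn (fun s => q s (v + (s - t) • w)) (Ici 0) := by
    intro t v w
    have hline : ContinuousOn (fun s : ℝ => v + (s - t) • w) (Ici 0) := by fun_prop
    exact (hline.dotProduct hline).sub ((hc.dotProduct hline).pow 2)
  have hwin : ∀ t, 0 ≤ t → ∀ v w, 1 / 2 * (δ * μ) * (v ⬝ᵥ v) - δ ^ 3 * (w ⬝ᵥ w) ≤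
      ∫ s in t..t + δ, q s (v + (s - t) • w) := by
    intro t ht v w
    have hsub : Icc t (t + δ) ⊆ Ici 0 := fun s hs => ht.trans hs.1
    have hle : t ≤ t + δ := by linarith
    have hint : IntervalIntegrable (fun s => q s v) MeasureTheory.volume t (t + δ) :=
      ContinuousOn.intervalIntegrable (by
        rw [uIcc_of_le hle]
        simpa using (hqc 0 v 0).mono hsub)
    calc 1 / 2 * (δ * μ) * (v ⬝ᵥ v) - δ ^ 3 * (w ⬝ᵥ w)
        ≤ 1 / 2 * (∫ s in t..t + δ, q s v) - δ * (δ ^ 2 * (w ⬝ᵥ w)) := by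
          linarith [hpe' t ht v]
      _ = ∫ s in t..t + δ, (1 / 2 * q s v - δ ^ 2 * (w ⬝ᵥ w)) := by
          rw [intervalIntegral.integral_sub (hint.const_mul _) (by simp),
            intervalIntegral.integral_const_mul, intervalIntegral.integral_const]
          simp
      _ ≤ ∫ s in t..t + δ, q s (v + (s - t) • w) := by
          refine intervalIntegral.integral_mono_on hle ((hint.const_mul _).sub (by simp))
            (ContinuousOn.intervalIntegrable (by
              rw [uIcc_of_le hle]
              exact (hqc t v w).mono hsub)) fun s hs => ?_
          refine le_trans ?_ (hqadd s (hsub hs) (s - t) v w)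
          have h1 : (s - t) ^ 2 ≤ δ ^ 2 :=
            pow_le_pow_left₀ (by linarith [hs.1]) (by linarith [hs.2]) 2
          have h2 := mul_le_mul_of_nonneg_right h1 (real_dotProduct_self_nonneg w)
          linarith
  -- The spacing between the two windows. It makes `δμ h² / 4 = 3δ³ + δμ / 2`, so twice the estimate
  -- at `t` plus the one at `t + h` cancels the `δ³ |w|²` losses and leaves `δμ (|v|² + |w|²) / 2 ≤
  -- 3J`; hence the constant `δμ / 6`.
  set h : ℝ := √(12 * δ ^ 2 / μ + 2) with hh
  have hh2 : h ^ 2 = 12 * δ ^ 2 / μ + 2 := Real.sq_sqrt (by positivity)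
  have hh0 : 0 ≤ h := Real.sqrt_nonneg _
  refine ⟨h + δ, δ * μ / 6, by positivity, by positivity, fun t ht v w => ?_⟩
  change _ ≤ ∫ s in t..t + (h + δ), q s (v + (s - t) • w)
  set J := ∫ s in t..t + (h + δ), q s (v + (s - t) • w) with hJ
  have hJint : IntervalIntegrable (fun s => q s (v + (s - t) • w)) MeasureTheory.volume t
      (t + (h + δ)) := ContinuousOn.intervalIntegrable (by
    rw [uIcc_of_le (by linarith)]
    exact (hqc t v w).mono fun s hs => ht.trans hs.1)
  have hsubint : ∀ r, 0 ≤ r → r ≤ h →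
      ∫ s in t + r..t + r + δ, q s (v + (s - t) • w) ≤ J := by
    intro r hr hrh
    refine intervalIntegral.integral_mono_interval (by linarith) (by linarith) (by linarith) ?_
      hJint
    refine (MeasureTheory.ae_restrict_mem measurableSet_Ioc).mono fun s hs => ?_
    exact hq0 s (ht.trans hs.1.le) _
  have h1 : 1 / 2 * (δ * μ) * (v ⬝ᵥ v) - δ ^ 3 * (w ⬝ᵥ w) ≤ J := by
    refine (hwin t ht v w).trans ?_
    simpa using hsubint 0 le_rfl hh0
  have h2 : 1 / 2 * (δ * μ) * ((v + h • w) ⬝ᵥ (v + h • w)) - δ ^ 3 * (w ⬝ᵥ w) ≤ J := by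
    refine (hwin (t + h) (by linarith) (v + h • w) w).trans (le_trans (le_of_eq ?_)
      (hsubint h hh0 le_rfl))
    refine intervalIntegral.integral_congr fun s _ => ?_
    have e : v + h • w + (s - (t + h)) • w = v + (s - t) • w := by module
    simp only [e]
  have h3 : 1 / 2 * h ^ 2 * (w ⬝ᵥ w) - v ⬝ᵥ v ≤ (v + h • w) ⬝ᵥ (v + h • w) := by
    have := real_dotProduct_self_nonneg ((2 : ℝ) • v + h • w)
    simp only [add_dotProduct, dotProduct_add, smul_dotProduct, dotProduct_smul, smul_eq_mul,
      dotProduct_comm w v] at this ⊢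
    linarith
  have h4 := mul_le_mul_of_nonneg_left h3 (show 0 ≤ 1 / 2 * (δ * μ) by positivity)
  have h5 : 1 / 2 * (δ * μ) * (1 / 2 * h ^ 2 * (w ⬝ᵥ w)) =
      3 * δ ^ 3 * (w ⬝ᵥ w) + 1 / 2 * (δ * μ) * (w ⬝ᵥ w) := by
    rw [hh2]
    field_simp
    ring
  linarith

end Excitation

/-! ### The position and velocity error system -/

section ErrorSystem

variable {g : ℝ}

lemma RigidMotion.transpose_mul_self (B : RigidMotion g) {t : ℝ} (ht : 0 ≤ t) :
    (B.Q t)ᵀ * B.Q t = 1 :=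
  (Matrix.mem_orthogonalGroup_iff' (Fin 3) ℝ).1
    (Matrix.mem_specialOrthogonalGroup_iff.1 (B.Q_mem t ht)).1

lemma RigidMotion.mul_transpose_self (B : RigidMotion g) {t : ℝ} (ht : 0 ≤ t) :
    B.Q t * (B.Q t)ᵀ = 1 :=
  (Matrix.mem_orthogonalGroup_iff (Fin 3) ℝ).1
    (Matrix.mem_specialOrthogonalGroup_iff.1 (B.Q_mem t ht)).1

lemma RigidMotion.mulVec_dotProduct_mulVec (B : RigidMotion g) {t : ℝ} (ht : 0 ≤ t)
    (x y : Fin 3 → ℝ) : (B.Q t *ᵥ x) ⬝ᵥ (B.Q t *ᵥ y) = x ⬝ᵥ y := by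
  rw [← dotProduct_transpose_mulVec_eq, Matrix.mulVec_mulVec, B.transpose_mul_self ht,
    Matrix.one_mulVec]

lemma RigidMotion.transpose_mulVec_dotProduct (B : RigidMotion g) {t : ℝ} (ht : 0 ≤ t)
    (x y : Fin 3 → ℝ) : ((B.Q t)ᵀ *ᵥ x) ⬝ᵥ ((B.Q t)ᵀ *ᵥ y) = x ⬝ᵥ y := by
  rw [dotProduct_transpose_mulVec_eq, Matrix.mulVec_mulVec, B.mul_transpose_self ht,
    Matrix.one_mulVec]

lemma RigidMotion.continuousOn_Q (B : RigidMotion g) : ContinuousOn B.Q (Ici 0) :=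
  MatHasDerivWithinAt.continuousOn B.Q_deriv

lemma RigidMotion.continuousOn_p (B : RigidMotion g) : ContinuousOn B.p (Ici 0) :=
  fun t ht => (B.p_deriv t ht).continuousWithinAt

lemma skew_transpose (ω : Fin 3 → ℝ) : (skew ω)ᵀ = -skew ω := by
  ext i j
  fin_cases i <;> fin_cases j <;> simp [skew]

lemma dotProduct_skew_mulVec (ω x : Fin 3 → ℝ) : x ⬝ᵥ (skew ω *ᵥ x) = 0 := by
  have h := dotProduct_transpose_mulVec_eq (skew ω) x x
  rw [skew_transpose, Matrix.neg_mulVec, dotProduct_neg, dotProduct_comm (skew ω *ᵥ x)] at h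
  linarith

lemma Continuous.skew {X : Type*} [TopologicalSpace X] {ω : X → Fin 3 → ℝ} (hω : Continuous ω) :
    Continuous fun t => skew (ω t) := by
  have h : ∀ i, Continuous fun t => ω t i := fun i => (continuous_apply i).comp hω
  refine continuous_pi fun i => continuous_pi fun j => ?_
  fin_cases i <;> fin_cases j <;> simp [_root_.skew] <;> fun_prop

lemma sum_dotProduct_self {m n : Type*} [Fintype m] [Fintype n] (x : m ⊕ n → ℝ) :
    x ⬝ᵥ x = (x ∘ Sum.inl) ⬝ᵥ (x ∘ Sum.inl) + (x ∘ Sum.inr) ⬝ᵥ (x ∘ Sum.inr) := by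
  simp [dotProduct]

lemma continuousOn_errorA {B : RigidMotion g} (hω : ContinuousOn B.ω (Ici 0)) :
    ContinuousOn (errorA B) (Ici 0) := by
  rw [continuousOn_iff_continuous_domRestrict] at *
  exact Continuous.matrix_fromBlocks hω.skew.neg continuous_const continuous_const hω.skew.neg

/-- The skew diagonal blocks vanish in the quadratic form; only the coupling `v ⬝ w` remains. -/
lemma abs_dotProduct_errorA_mulVec_le (B : RigidMotion g) (t : ℝ) (x : Fin 3 ⊕ Fin 3 → ℝ) :
    |x ⬝ᵥ (errorA B t *ᵥ x)| ≤ 1 * (x ⬝ᵥ x) := by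
  obtain ⟨v, w, rfl⟩ : ∃ v w, x = Sum.elim v w := ⟨_, _, (Sum.elim_comp_inl_inr x).symm⟩
  have e : Sum.elim v w ⬝ᵥ (errorA B t *ᵥ Sum.elim v w) = v ⬝ᵥ w := by
    rw [errorA, Matrix.fromBlocks_mulVec, sumElim_dotProduct_sumElim]
    simp [Matrix.neg_mulVec, dotProduct_skew_mulVec]
  rw [e, sumElim_dotProduct_sumElim, abs_le]
  have h1 := two_mul_dotProduct_le one_pos v w
  have h2 := two_mul_dotProduct_le one_pos v (-w)
  rw [neg_dotProduct_neg, dotProduct_neg] at h2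
  have h3 := real_dotProduct_self_nonneg v
  have h4 := real_dotProduct_self_nonneg w
  constructor <;> linarith

variable {B T : RigidMotion g}

lemma continuousOn_relPos (B T : RigidMotion g) : ContinuousOn (relPos B T) (Ici 0) :=
  B.continuousOn_Q.matrix_transpose.matrix_mulVec (B.continuousOn_p.sub T.continuousOn_p)

lemma euclNorm_ne_zero {n : Type*} [Fintype n] {x : n → ℝ} (hx : x ≠ 0) : euclNorm x ≠ 0 := by
  intro h
  have h2 := euclNorm_sq x
  rw [h, zero_pow two_ne_zero] at h2
  exact hx (dotProduct_self_eq_zero.1 h2.symm)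

lemma continuousOn_bearing (hξ : ∀ t, 0 ≤ t → relPos B T t ≠ 0) :
    ContinuousOn (bearing B T) (Ici 0) := by
  have hn : ContinuousOn (fun t => euclNorm (relPos B T t)) (Ici 0) := by
    simp only [euclNorm_eq_sqrt]
    exact ((continuousOn_relPos B T).dotProduct (continuousOn_relPos B T)).sqrt
  exact (hn.inv₀ fun t ht => euclNorm_ne_zero (hξ t ht)).smul (continuousOn_relPos B T)

lemma bearing_dotProduct_self {t : ℝ} (hξ : relPos B T t ≠ 0) :
    bearing B T t ⬝ᵥ bearing B T t = 1 := by
  have h := euclNorm_ne_zero hξ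
  rw [bearing, smul_dotProduct, dotProduct_smul, ← euclNorm_sq, smul_eq_mul, smul_eq_mul]
  field_simp

lemma continuousOn_errorC (hξ : ∀ t, 0 ≤ t → relPos B T t ≠ 0) :
    ContinuousOn (errorC B T) (Ici 0) := by
  have h := (continuousOn_bearing hξ).proj
  refine continuousOn_pi.2 fun i => continuousOn_pi.2 fun j => ?_
  rcases j with j | j
  · exact continuousOn_pi.1 (continuousOn_pi.1 h i) j
  · exact continuousOn_const

lemma errorC_mulVec_dotProduct_self {t : ℝ} (hξ : relPos B T t ≠ 0) (x : Fin 3 ⊕ Fin 3 → ℝ) :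
    (errorC B T t *ᵥ x) ⬝ᵥ (errorC B T t *ᵥ x) =
      (x ∘ Sum.inl) ⬝ᵥ (x ∘ Sum.inl) - (bearing B T t ⬝ᵥ (x ∘ Sum.inl)) ^ 2 := by
  rw [errorC, Matrix.fromCols_mulVec, Matrix.zero_mulVec, add_zero,
    proj_mulVec_dotProduct_self (bearing_dotProduct_self hξ)]

/-- The transition matrix of the error system, a double integrator in the inertial frame. -/
noncomputable def errorTransition (B : RigidMotion g) (s t : ℝ) :
    Matrix (Fin 3 ⊕ Fin 3) (Fin 3 ⊕ Fin 3) ℝ :=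
  Matrix.fromBlocks ((B.Q s)ᵀ * B.Q t) ((s - t) • ((B.Q s)ᵀ * B.Q t)) 0 ((B.Q s)ᵀ * B.Q t)

lemma isTransitionMatrix_errorTransition (B : RigidMotion g) :
    IsTransitionMatrix (errorA B) (errorTransition B) := by
  refine fun t ht => ⟨?_, fun s hs => ?_⟩
  · rw [errorTransition, B.transpose_mul_self ht, sub_self, zero_smul, Matrix.fromBlocks_one]
  · have hQ : MatHasDerivWithinAt (fun τ => (B.Q τ)ᵀ * B.Q t)
        (-skew (B.ω s) * ((B.Q s)ᵀ * B.Q t)) (Ici 0) s := by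
      convert (B.Q_deriv s hs).transpose.mul (MatHasDerivWithinAt.const (B.Q t) (Ici 0) s) using 1
      rw [Matrix.transpose_mul, skew_transpose, Matrix.mul_zero, add_zero, Matrix.mul_assoc]
    rw [errorA, errorTransition, Matrix.fromBlocks_multiply]
    simp only [Matrix.mul_zero, Matrix.zero_mul, add_zero, zero_add, Matrix.one_mul]
    rintro (i | i) (j | j)
    · exact hQ i j
    · have h := ((hasDerivWithinAt_id s (Ici 0)).sub_const t).mul (hQ i j)
      refine h.congr_deriv ?_
      simp [add_comm]
    · exact hasDerivWithinAt_const s _ _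
    · exact hQ i j

lemma continuousOn_errorTransition (B : RigidMotion g) {t : ℝ} (ht : 0 ≤ t) :
    ContinuousOn (fun s => errorTransition B s t) (Ici 0) :=
  MatHasDerivWithinAt.continuousOn (isTransitionMatrix_errorTransition B t ht).2

/-- The factor `Q_B(s)ᵀ` in the transition matrix is an isometry and can be moved onto the bearing,
turning it into the inertial bearing. -/
lemma errorC_errorTransition_mulVec (hξ : ∀ t, 0 ≤ t → relPos B T t ≠ 0) {s t : ℝ} (hs : 0 ≤ s)
    (x : Fin 3 ⊕ Fin 3 → ℝ) :
    (errorC B T s *ᵥ (errorTransition B s t *ᵥ x)) ⬝ᵥ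
        (errorC B T s *ᵥ (errorTransition B s t *ᵥ x)) =
      (B.Q t *ᵥ (x ∘ Sum.inl) + (s - t) • (B.Q t *ᵥ (x ∘ Sum.inr))) ⬝ᵥ
        (B.Q t *ᵥ (x ∘ Sum.inl) + (s - t) • (B.Q t *ᵥ (x ∘ Sum.inr))) -
      (inertialBearing B T s ⬝ᵥ
        (B.Q t *ᵥ (x ∘ Sum.inl) + (s - t) • (B.Q t *ᵥ (x ∘ Sum.inr)))) ^ 2 := by
  have e : (errorTransition B s t *ᵥ x) ∘ Sum.inl =
      (B.Q s)ᵀ *ᵥ (B.Q t *ᵥ (x ∘ Sum.inl) + (s - t) • (B.Q t *ᵥ (x ∘ Sum.inr))) := by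
    rw [errorTransition, Matrix.fromBlocks_mulVec, Sum.elim_comp_inl, Matrix.smul_mulVec,
      ← Matrix.mulVec_mulVec, ← Matrix.mulVec_mulVec, Matrix.mulVec_add, Matrix.mulVec_smul]
  rw [errorC_mulVec_dotProduct_self (hξ s hs), e, B.transpose_mulVec_dotProduct hs,
    dotProduct_transpose_mulVec_eq]
  rfl

theorem uniformlyObservable_error (hξ : ∀ t, 0 ≤ t → relPos B T t ≠ 0)
    (hPE : PersistentlyExciting (inertialBearing B T)) :
    UniformlyObservable (errorA B) (errorC B T) := by
  have hc : ContinuousOn (inertialBearing B T) (Ici 0) :=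
    B.continuousOn_Q.matrix_mulVec (continuousOn_bearing hξ)
  have hu : ∀ t, 0 ≤ t → inertialBearing B T t ⬝ᵥ inertialBearing B T t = 1 := fun t ht => by
    rw [inertialBearing, B.mulVec_dotProduct_mulVec ht, bearing_dotProduct_self (hξ t ht)]
  obtain ⟨δ, μ, hδ, hμ, h⟩ := hPE.exists_affine_bound hc hu
  -- The Gramian is averaged over the window and the affine bound is not, hence `μ / δ`.
  refine ⟨errorTransition B, isTransitionMatrix_errorTransition B, δ, μ / δ, hδ, by positivity,
    fun t ht => loewnerGE_iff.2 ⟨?_, fun x => ?_⟩⟩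
  · rw [gramian, Matrix.transpose_smul, matIntegral_transpose_eq]
    intro s
    simp only [Matrix.transpose_mul, Matrix.transpose_transpose, Matrix.mul_assoc]
  · have hle : t ≤ t + δ := by linarith
    have hsub : Icc t (t + δ) ⊆ Ici 0 := fun s hs => ht.trans hs.1
    have hΦ := continuousOn_errorTransition B ht
    have hC := continuousOn_errorC hξ
    rw [gramian, Matrix.smul_mulVec, dotProduct_smul, smul_eq_mul, dotProduct_matIntegral_mulVec hle
      ((((hΦ.matrix_transpose.matrix_mul hC.matrix_transpose).matrix_mul hC).matrix_mul hΦ).mono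
        hsub)]
    have e : ∫ s in t..t + δ, x ⬝ᵥ (((errorTransition B s t)ᵀ * (errorC B T s)ᵀ * errorC B T s *
        errorTransition B s t) *ᵥ x) = ∫ s in t..t + δ,
        (B.Q t *ᵥ (x ∘ Sum.inl) + (s - t) • (B.Q t *ᵥ (x ∘ Sum.inr))) ⬝ᵥ
          (B.Q t *ᵥ (x ∘ Sum.inl) + (s - t) • (B.Q t *ᵥ (x ∘ Sum.inr))) -
        (inertialBearing B T s ⬝ᵥ
          (B.Q t *ᵥ (x ∘ Sum.inl) + (s - t) • (B.Q t *ᵥ (x ∘ Sum.inr)))) ^ 2 := by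
      refine intervalIntegral.integral_congr fun s hs => ?_
      rw [uIcc_of_le hle] at hs
      simp only [← errorC_errorTransition_mulVec hξ (hsub hs), ← Matrix.mulVec_mulVec]
      rw [dotProduct_transpose_mulVec_eq, dotProduct_transpose_mulVec_eq]
    have h1 := h t ht (B.Q t *ᵥ (x ∘ Sum.inl)) (B.Q t *ᵥ (x ∘ Sum.inr))
    rw [B.mulVec_dotProduct_mulVec ht, B.mulVec_dotProduct_mulVec ht, ← sum_dotProduct_self] at h1
    rw [e, div_mul_eq_mul_div, one_div, ← div_eq_inv_mul]
    exact div_le_div_of_nonneg_right h1 hδ.le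

end ErrorSystem

theorem lemma2 (g : ℝ) (B T : RigidMotion g)
    (hBuc : UniformContinuousOn B.ω (Set.Ici 0))
    (hTuc : UniformContinuousOn T.ω (Set.Ici 0))
    (hBbd : ∃ M : ℝ, ∀ t, 0 ≤ t → euclNorm (B.ω t) ≤ M)
    (hTbd : ∃ M : ℝ, ∀ t, 0 ≤ t → euclNorm (T.ω t) ≤ M)
    (hξ : ∀ t, 0 ≤ t → relPos B T t ≠ 0)
    (hPE : PersistentlyExciting (inertialBearing B T)) :
    UniformlyObservable (errorA B) (errorC B T) ∧
    ∀ (S : ℝ → Matrix (Fin 3 ⊕ Fin 3) (Fin 3 ⊕ Fin 3) ℝ) (D : ℝ → Matrix (Fin 3) (Fin 3) ℝ)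
      (P₀ : Matrix (Fin 3 ⊕ Fin 3) (Fin 3 ⊕ Fin 3) ℝ),
      IsWeight S → IsWeight D → P₀.PosDef →
      (∃ P, IsRiccatiSolution (errorA B) (errorC B T) D S P ∧ P 0 = P₀) ∧
      (∀ P P', IsRiccatiSolution (errorA B) (errorC B T) D S P → P 0 = P₀ →
        IsRiccatiSolution (errorA B) (errorC B T) D S P' → P' 0 = P₀ →
        Set.EqOn P P' (Set.Ici 0)) ∧
      (∀ P, IsRiccatiSolution (errorA B) (errorC B T) D S P → P 0 = P₀ →
        GloballyExponentiallyStable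
          (fun t => errorA B t - riccatiGain (errorC B T) D P t * errorC B T t)) := by
  have hobs := uniformlyObservable_error hξ hPE
  refine ⟨hobs, fun S D P₀ hS hD hP₀ => ?_⟩
  -- Both structural constants are `1`: the form of `A` is bounded by its coupling block, and `C` is
  -- a projection of the position half.
  refine hobs.riccati_observer (continuousOn_errorA hBuc.continuousOn) (continuousOn_errorC hξ)
    zero_le_one zero_le_one (fun t _ x => abs_dotProduct_errorA_mulVec_le B t x) (fun t ht x => ?_)
    hS hD hP₀
  rw [errorC_mulVec_dotProduct_self (hξ t ht), sum_dotProduct_self x]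
  linarith [sq_nonneg (bearing B T t ⬝ᵥ (x ∘ Sum.inl)), real_dotProduct_self_nonneg (x ∘ Sum.inr)]
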